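/- Let $n\ge 1$, let $\Omega\subset\mathbf R^n$ be a (nonempty) bounded convex domain, $D:=\Omega\times(0,\infty)$, let $f=f(x,t,v,\theta)$ be a nonnegative continuous function on $D\times\mathbf R\times\mathbf R^n$, and let $0<p<1$ and $1/2\le\alpha\le 1$. Let $u\in C^{2,1}(D)\cap C(\overline D)$ satisfy $$\partial_t u=\Delta u+f(x,t,u,\nabla u)\ \text{ in } D\quad (1),\qquad u=0\ \text{ on } \partial D .$$ Notation. For $q>0$ and $m\ge2$ let $\Lambda_m:=\{\lambda\in(0,1)^m:\sum_i\lambda_i=1\}$, and for $a\in[0,\infty)^m$, $\lambda\in\Lambda_m$ let $M_q(a;\lambda):=\big(\sum_i\lambda_i a_i^q\big)^{1/q}$. For $\lambda\in\Lambda_{n+1}$ and $(x,t)\in\overline D$ let $$u_{\alpha,p,\lambda}(x,t):=\sup\Big\{M_p\big((u(y_i,\tau_i))_{i=1}^{n+1};\lambda\big):(y_i,\tau_i)\in\overline D,\ x=\sum_{i=1}^{n+1}\lambda_iy_i,\ t=M_\alpha\big((\tau_i)_{i=1}^{n+1};\lambda\big)\Big\}$$ (the $\alpha$-parabolically $p$-concave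 $\lambda$-envelope of $u$) and $u_{\alpha,p}:=\sup_{\lambda\in\Lambda_{n+1}}u_{\alpha,p,\lambda}$. The function $u$ is called $\alpha$-parabolically $p$-concave in $\overline D$ if it is nonnegative there and, for all $(x_1,t_1),(x_2,t_2)\in\overline D$ and $\mu\in(0,1)$, $$u\big((1-\mu)x_1+\mu x_2,\,[(1-\mu)t_1^\alpha+\mu t_2^\alpha]^{1/\alpha}\big)\ge\big[(1-\mu)u(x_1,t_1)^p+\mu u(x_2,t_2)^p\big]^{1/p}.$$ An upper semicontinuous function $v$ on $D$ is a viscosity subsolution of (1) if, for every $(x_0,t_0)\in D$ and every $\phi\in C^{2,1}(D)$ with $\phi(x_0,t_0)=v(x_0,t_0)$ and $\phi\ge v$ near $(x_0,t_0)$, one has $\partial_t\phi\le\Delta\phi+f(x,t,\phi,\nabla\phi)$ at $(x_0,t_0)$. The weak comparison principle (WCP) for (1) is the property: if $w\in C(\overline D)\cap C^{2,1}(D)$ is a nonnegative classical solution of (1), $v\in C(\overline D)$ is a nonnegative viscosity subsolution of (1), and $w\ge v$ on $\partial D$, then $w\ge v$ in $\overline D$. Assume: (i) $\partial_tu\ge0$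 in $D$; (ii) for all $x\in\overline\Omega$ and $y\in\Omega$, $\displaystyle\lim_{\rho\to0+}\frac{u(x+\nu\rho,\rho^{1/\alpha})^p}{\rho}=\infty$, where $\nu=\frac{y-x}{|y-x|}$ if $x\ne y$ and $\nu=0$ if $x=y$; (iii) for each fixed $\theta\in\mathbf R^n$, the function $(x,t,v)\mapsto v^{3-1/p}f(x,t^{1/\alpha},v^{1/p},v^{1/p-1}\theta)$ is concave on $D\times(0,\infty)$. Then, for every $\lambda\in\Lambda_{n+1}$, the supremum $u_{\alpha,p,\lambda}$ is finite on $\overline D$, and $u_{\alpha,p,\lambda}$ is a viscosity subsolution of (1) with $u_{\alpha,p,\lambda}=0$ on $\partial D$. If in addition (WCP) holds for (1), then $u=u_{\alpha,p}$ in $\overline D$ and $u$ is $\alpha$-parabolically $p$-concave in $\overline D$. -/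

import Mathlib

open Set Filter Topology

noncomputable section

namespace ParabolicPowerConcavity

/-- The parabolic cylinder `D = Ω × (0, ∞)`, a subset of `ℝⁿ × ℝ`. -/
def cyl {n : ℕ} (Ω : Set (EuclideanSpace ℝ (Fin n))) : Set (EuclideanSpace ℝ (Fin n) × ℝ) :=
  Ω ×ˢ Ioi (0 : ℝ)

/-- The time derivative `∂ₜ φ` at the point `z = (x, t)`. -/
def dt {n : ℕ} (φ : EuclideanSpace ℝ (Fin n) × ℝ → ℝ)
    (z : EuclideanSpace ℝ (Fin n) × ℝ) : ℝ :=
  deriv (fun t : ℝ => φ (z.1, t)) z.2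

/-- The spatial gradient `∇ φ` at the point `z = (x, t)`. -/
def gradX {n : ℕ} (φ : EuclideanSpace ℝ (Fin n) × ℝ → ℝ)
    (z : EuclideanSpace ℝ (Fin n) × ℝ) : EuclideanSpace ℝ (Fin n) :=
  gradient (fun x : EuclideanSpace ℝ (Fin n) => φ (x, z.2)) z.1

/-- The spatial Laplacian `Δ φ` at the point `z = (x, t)`. -/
def lapX {n : ℕ} (φ : EuclideanSpace ℝ (Fin n) × ℝ → ℝ)
    (z : EuclideanSpace ℝ (Fin n) × ℝ) : ℝ :=
  Laplacian.laplacian (fun x : EuclideanSpace ℝ (Fin n) => φ (x, z.2)) z.1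

/-- The class `C^{2,1}(D)` for an open set `D` of space-time: the function, its spatial derivatives
up to order two and its first time derivative exist in `D` and are (jointly) continuous there. -/
structure C21On {n : ℕ} (D : Set (EuclideanSpace ℝ (Fin n) × ℝ))
    (φ : EuclideanSpace ℝ (Fin n) × ℝ → ℝ) : Prop where
  continuousOn : ContinuousOn φ D
  contDiffAt_space : ∀ z ∈ D,
    ContDiffAt ℝ 2 (fun x : EuclideanSpace ℝ (Fin n) => φ (x, z.2)) z.1
  differentiableAt_time : ∀ z ∈ D, DifferentiableAt ℝ (fun t : ℝ => φ (z.1, t)) z.2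
  continuousOn_fderiv : ContinuousOn (fun z : EuclideanSpace ℝ (Fin n) × ℝ =>
    fderiv ℝ (fun x : EuclideanSpace ℝ (Fin n) => φ (x, z.2)) z.1) D
  continuousOn_hessian : ContinuousOn (fun z : EuclideanSpace ℝ (Fin n) × ℝ =>
    iteratedFDeriv ℝ 2 (fun x : EuclideanSpace ℝ (Fin n) => φ (x, z.2)) z.1) D
  continuousOn_dt : ContinuousOn (dt φ) D

/-- `u ∈ C^{2,1}(D) ∩ C(D̄)` solves `∂ₜ u = Δ u + f(x, t, u, ∇u)` in `D = Ω × (0, ∞)`. -/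
structure IsClassicalSolution {n : ℕ} (Ω : Set (EuclideanSpace ℝ (Fin n)))
    (f : EuclideanSpace ℝ (Fin n) → ℝ → ℝ → EuclideanSpace ℝ (Fin n) → ℝ)
    (u : EuclideanSpace ℝ (Fin n) × ℝ → ℝ) : Prop where
  c21 : C21On (cyl Ω) u
  continuousOn_closure : ContinuousOn u (closure (cyl Ω))
  eqn : ∀ z ∈ cyl Ω, dt u z = lapX u z + f z.1 z.2 (u z) (gradX u z)

/-- `v` is a viscosity subsolution of `∂ₜ v = Δ v + f(x, t, v, ∇v)` in `D = Ω × (0, ∞)`. -/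
structure IsViscositySubsolution {n : ℕ} (Ω : Set (EuclideanSpace ℝ (Fin n)))
    (f : EuclideanSpace ℝ (Fin n) → ℝ → ℝ → EuclideanSpace ℝ (Fin n) → ℝ)
    (v : EuclideanSpace ℝ (Fin n) × ℝ → ℝ) : Prop where
  usc : UpperSemicontinuousOn v (cyl Ω)
  test : ∀ z₀ ∈ cyl Ω, ∀ φ : EuclideanSpace ℝ (Fin n) × ℝ → ℝ, C21On (cyl Ω) φ →
    φ z₀ = v z₀ → (∀ᶠ z in 𝓝 z₀, v z ≤ φ z) →
    dt φ z₀ ≤ lapX φ z₀ + f z₀.1 z₀.2 (φ z₀) (gradX φ z₀)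

/-- The weak comparison principle for `∂ₜ u = Δ u + f(x, t, u, ∇u)` in `D = Ω × (0, ∞)`: a
nonnegative classical solution which dominates a nonnegative viscosity subsolution, continuous on
`D̄`, on `∂D` dominates it on `D̄`. -/
def WCP {n : ℕ} (Ω : Set (EuclideanSpace ℝ (Fin n)))
    (f : EuclideanSpace ℝ (Fin n) → ℝ → ℝ → EuclideanSpace ℝ (Fin n) → ℝ) : Prop :=
  ∀ u v : EuclideanSpace ℝ (Fin n) × ℝ → ℝ,
    IsClassicalSolution Ω f u → (∀ z ∈ closure (cyl Ω), 0 ≤ u z) →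
    ContinuousOn v (closure (cyl Ω)) → IsViscositySubsolution Ω f v →
    (∀ z ∈ closure (cyl Ω), 0 ≤ v z) →
    (∀ z ∈ frontier (cyl Ω), v z ≤ u z) →
    ∀ z ∈ closure (cyl Ω), v z ≤ u z

/-- The set `Λ_m` of weights `(λ₁, …, λ_m) ∈ (0, 1)^m` with sum one. -/
def Weights (m : ℕ) : Set (Fin m → ℝ) :=
  {w | (∀ i, w i ∈ Ioo (0 : ℝ) 1) ∧ ∑ i, w i = 1}

/-- The `w`-weighted `p`-mean of nonnegative numbers `a₁, …, a_m`, for a positive real exponent `p`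
(the only exponents used here). -/
def powerMean {m : ℕ} (p : ℝ) (a w : Fin m → ℝ) : ℝ :=
  (∑ i, w i * a i ^ p) ^ (1 / p)

/-- The `p`-mean of two nonnegative numbers with ratio `l`, for a positive real exponent `p`. -/
def powerMeanTwo (p a b l : ℝ) : ℝ :=
  ((1 - l) * a ^ p + l * b ^ p) ^ (1 / p)

/-- `v` is (nonnegative and) `α`-parabolically `p`-concave on a set `Q` of space-time, for positive
real `α` and `p`; here `Q` is a cylinder `K × (0, ∞)` or `K × [0, ∞)` with `K` convex. -/
def IsParabolicallyConcaveOn {n : ℕ} (α p : ℝ) (Q : Set (EuclideanSpace ℝ (Fin n) × ℝ))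
    (v : EuclideanSpace ℝ (Fin n) × ℝ → ℝ) : Prop :=
  (∀ z ∈ Q, 0 ≤ v z) ∧
  ∀ z₁ ∈ Q, ∀ z₂ ∈ Q, ∀ l ∈ Ioo (0 : ℝ) 1,
    powerMeanTwo p (v z₁) (v z₂) l ≤
      v ((1 - l) • z₁.1 + l • z₂.1, powerMeanTwo α z₁.2 z₂.2 l)

/-- The set of values whose supremum is the `λ`-envelope at the point `z = (x, t)`. -/
def envelopeValues {n : ℕ} (Ω : Set (EuclideanSpace ℝ (Fin n))) (α p : ℝ)
    (w : Fin (n + 1) → ℝ) (u : EuclideanSpace ℝ (Fin n) × ℝ → ℝ)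
    (z : EuclideanSpace ℝ (Fin n) × ℝ) : Set ℝ :=
  {r | ∃ ζ : Fin (n + 1) → EuclideanSpace ℝ (Fin n) × ℝ,
    (∀ i, ζ i ∈ closure (cyl Ω)) ∧
    z.1 = ∑ i, w i • (ζ i).1 ∧
    z.2 = powerMean α (fun i => (ζ i).2) w ∧
    r = powerMean p (fun i => u (ζ i)) w}

/-- The `α`-parabolically `p`-concave `λ`-envelope `u_{α,p,λ}` of `u` (with `λ = w`). -/
def lambdaEnvelope {n : ℕ} (Ω : Set (EuclideanSpace ℝ (Fin n))) (α p : ℝ)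
    (w : Fin (n + 1) → ℝ) (u : EuclideanSpace ℝ (Fin n) × ℝ → ℝ)
    (z : EuclideanSpace ℝ (Fin n) × ℝ) : ℝ :=
  sSup (envelopeValues Ω α p w u z)

/-- The `α`-parabolically `p`-concave envelope `u_{α,p} = sup_λ u_{α,p,λ}` of `u`. -/
def envelope {n : ℕ} (Ω : Set (EuclideanSpace ℝ (Fin n))) (α p : ℝ)
    (u : EuclideanSpace ℝ (Fin n) × ℝ → ℝ) (z : EuclideanSpace ℝ (Fin n) × ℝ) : ℝ :=
  sSup ((fun w => lambdaEnvelope Ω α p w u z) '' Weights (n + 1))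

/-- The unit vector pointing from `x` to `y`; it is `0` if `x = y`. -/
def direction {n : ℕ} (x y : EuclideanSpace ℝ (Fin n)) : EuclideanSpace ℝ (Fin n) :=
  ‖y - x‖⁻¹ • (y - x)

end ParabolicPowerConcavity

end

/-!
Each `λ`-envelope is attained, by compactness of the set of competitors. At a point `z₀` of `D`, the
competitors realizing it lie in `D` (`mem_cyl_of_eq_lambdaEnvelope`): the growth condition makes it
profitable to move a boundary competitor inwards. This also gives the continuity of the envelope on
the closure of `D` (`continuousOn_lambdaEnvelope`).

Let `φ` touch the envelope from above at `z₀ = (x₀, t₀)`, let `ζᵢ = (yᵢ, τᵢ)` be competitors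
realizing the envelope there, and write `aᵢ = u (ζᵢ)`, `v = φ z₀`. Then the function
`φ (combine ζ') ^ p - ∑ wᵢ u (ζ'ᵢ) ^ p` of nearby competitors `ζ'` has a minimum, with value zero,
at `ζ`. The first order conditions say that `aᵢ ^ (p - 1) ∇u (ζᵢ)` and
`aᵢ ^ (p - 1) ∂ₜu (ζᵢ) (τᵢ ^ α) ^ (1 / α - 1)` do not depend on `i` and coincide with the
corresponding quantities of `φ` at `z₀`. In the second order condition in space, `yᵢ` moves with
speed `cᵢ = aᵢ ^ p / v ^ p`; with this choice the gradient terms cancel and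
`∑ wᵢ cᵢ ^ 2 aᵢ ^ (p - 1) Δu (ζᵢ) ≤ v ^ (p - 1) Δφ z₀` (`sum_mul_hessian_le_of_isLocalMin`).
Now insert the equation for `u`. The nonlinear terms are compared by Jensen's inequality for the
concave function `v ^ (3 - 1 / p) f` (`sum_nonlinearity_le`). The time derivatives are nonnegative,
and are compared by joint convexity of `(A, s) ↦ A ^ 2 / s ^ (1 / α - 1)`, which is where
`1 / 2 ≤ α ≤ 1` enters (`sq_sum_div_rpow_le`). So the envelope is a viscosity subsolution.

The envelope vanishes on the boundary of `D` because a convex combination of points of the closure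
lies in the interior as soon as one of the points does. The comparison principle therefore bounds
every `λ`-envelope by `u`; the reverse inequality is trivial, and the equality of `u` with its
envelopes contains parabolic concavity, as `n + 1 ≥ 2` competitors are allowed.
-/

namespace ParabolicPowerConcavity

/-! ### Calculus preliminaries -/

/-- No differentiability is needed: a negative second derivative at a minimum would make the function
locally constant. -/
theorem deriv_deriv_nonneg_of_isLocalMin {g : ℝ → ℝ} {x₀ : ℝ} (hg : IsLocalMin g x₀)
    (hc : ContinuousAt g x₀) : 0 ≤ deriv (deriv g) x₀ := by
  by_contra! hneg
  have hmax : IsLocalMax g x₀ := isLocalMax_of_deriv_deriv_neg hneg hg.deriv_eq_zero hc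
  have hconst : g =ᶠ[𝓝 x₀] fun _ => g x₀ := by
    filter_upwards [hg, hmax] with r h₁ h₂ using le_antisymm h₂ h₁
  have hzero : deriv (deriv g) x₀ = 0 := by
    rw [hconst.deriv.deriv_eq]
    simp
  exact hneg.ne hzero

section LinePower

variable {E : Type*} [NormedAddCommGroup E] [NormedSpace ℝ E]

theorem hasDerivAt_comp_line {h : E → ℝ} {x e : E} {r : ℝ}
    (hh : DifferentiableAt ℝ h (x + r • e)) :
    HasDerivAt (fun s : ℝ => h (x + s • e)) (fderiv ℝ h (x + r • e) e) r := by
  have hl : HasDerivAt (fun s : ℝ => x + s • e) e r := by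
    simpa using ((hasDerivAt_id r).smul_const e).const_add x
  exact hh.hasFDerivAt.comp_hasDerivAt r hl

theorem hasDerivAt_rpow_comp_line {h : E → ℝ} {x e : E} {r : ℝ} (p : ℝ)
    (hh : DifferentiableAt ℝ h (x + r • e)) (hpos : 0 < h (x + r • e)) :
    HasDerivAt (fun s : ℝ => h (x + s • e) ^ p)
      (p * h (x + r • e) ^ (p - 1) * fderiv ℝ h (x + r • e) e) r := by
  convert (hasDerivAt_comp_line hh).rpow_const (p := p) (Or.inl hpos.ne') using 1
  ring

theorem contDiffAt_rpow_comp_line {h : E → ℝ} {x : E} (e : E) (p : ℝ)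
    (hh : ContDiffAt ℝ 2 h x) (hpos : 0 < h x) :
    ContDiffAt ℝ 2 (fun s : ℝ => h (x + s • e) ^ p) 0 := by
  have hl : ContDiffAt ℝ 2 (fun s : ℝ => x + s • e) 0 := by fun_prop
  have hh' : ContDiffAt ℝ 2 h (x + (0 : ℝ) • e) := by simpa using hh
  have := hh'.comp (0 : ℝ) hl
  exact this.rpow_const_of_ne (by simpa using hpos.ne')

theorem deriv_deriv_rpow_comp_line {h : E → ℝ} {x : E} (e : E) (p : ℝ)
    (hh : ContDiffAt ℝ 2 h x) (hpos : 0 < h x) :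
    deriv (deriv fun s : ℝ => h (x + s • e) ^ p) 0 =
      p * (h x ^ (p - 1) * iteratedFDeriv ℝ 2 h x ![e, e] +
        (p - 1) * (h x ^ (p - 2) * fderiv ℝ h x e ^ 2)) := by
  have hl : ContinuousAt (fun s : ℝ => x + s • e) 0 := by fun_prop
  have hl' : Tendsto (fun s : ℝ => x + s • e) (𝓝 0) (𝓝 x) := by
    simpa [ContinuousAt] using hl
  have hd : ∀ᶠ y in 𝓝 x, DifferentiableAt ℝ h y := by
    filter_upwards [hh.eventually (by simp)] with y hy using hy.differentiableAt (by simp)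
  have hderiv : (deriv fun s : ℝ => h (x + s • e) ^ p) =ᶠ[𝓝 0]
      fun s => p * h (x + s • e) ^ (p - 1) * fderiv ℝ h (x + s • e) e := by
    filter_upwards [hl'.eventually hd, hl'.eventually (hh.continuousAt.eventually_const_lt hpos)]
      with s hs₁ hs₂ using (hasDerivAt_rpow_comp_line p hs₁ hs₂).deriv
  rw [hderiv.deriv_eq]
  have hx0 : x + (0 : ℝ) • e = x := by simp
  have h₁ : HasDerivAt (fun s : ℝ => h (x + s • e) ^ (p - 1))
      ((p - 1) * h x ^ (p - 1 - 1) * fderiv ℝ h x e) 0 := by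
    have := hasDerivAt_rpow_comp_line (x := x) (e := e) (r := 0) (p - 1)
      (by rw [hx0]; exact hh.differentiableAt (by simp)) (by rwa [hx0])
    rwa [hx0] at this
  have hfd : DifferentiableAt ℝ (fderiv ℝ h) x :=
    (hh.fderiv_right (m := 1) (by norm_num)).differentiableAt (by simp)
  have h₂ : HasDerivAt (fun s : ℝ => fderiv ℝ h (x + s • e) e)
      (fderiv ℝ (fderiv ℝ h) x e e) 0 := by
    have hline : HasDerivAt (fun s : ℝ => x + s • e) e 0 := by
      simpa using ((hasDerivAt_id (0 : ℝ)).smul_const e).const_add x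
    have hfd' : HasFDerivAt (fderiv ℝ h) (fderiv ℝ (fderiv ℝ h) x) (x + (0 : ℝ) • e) := by
      rw [hx0]; exact hfd.hasFDerivAt
    have := hfd'.comp_hasDerivAt (0 : ℝ) hline
    simpa using this.clm_apply (hasDerivAt_const (0 : ℝ) e)
  have h₃ := (h₁.const_mul p).mul h₂
  refine h₃.deriv.trans ?_
  rw [hx0, iteratedFDeriv_two_apply]
  have : p - 1 - 1 = p - 2 := by ring
  rw [this]
  simp
  ring

end LinePower

theorem laplacian_eq_sum_stdBasis {n : ℕ} (h : EuclideanSpace ℝ (Fin n) → ℝ)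
    (x : EuclideanSpace ℝ (Fin n)) :
    Laplacian.laplacian h x = ∑ i, iteratedFDeriv ℝ 2 h x
      ![EuclideanSpace.basisFun (Fin n) ℝ i, EuclideanSpace.basisFun (Fin n) ℝ i] := by
  rw [InnerProductSpace.laplacian_eq_iteratedFDeriv_orthonormalBasis h
    (EuclideanSpace.basisFun (Fin n) ℝ)]

/-- Continuity of the partial derivatives gives differentiability in space and time jointly. -/
theorem C21On.differentiableAt {n : ℕ} {D : Set (EuclideanSpace ℝ (Fin n) × ℝ)}
    {φ : EuclideanSpace ℝ (Fin n) × ℝ → ℝ} (hD : IsOpen D) (hφ : C21On D φ)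
    {z : EuclideanSpace ℝ (Fin n) × ℝ} (hz : z ∈ D) : DifferentiableAt ℝ φ z := by
  have hev : ∀ᶠ v in 𝓝 z, v ∈ D := hD.mem_nhds hz
  have := hasStrictFDerivAt_uncurry_coprod (𝕜 := ℝ) (u := z) (f := fun x t => φ (x, t))
    (f₁ := fun x t => fderiv ℝ (fun y => φ (y, t)) x)
    (f₂ := fun x t => ContinuousLinearMap.toSpanSingleton ℝ (dt φ (x, t)))
    (by
      filter_upwards [hev] with v hv
      exact ((hφ.contDiffAt_space v hv).differentiableAt (by simp)).hasFDerivAt)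
    (by
      filter_upwards [hev] with v hv
      exact (hφ.differentiableAt_time v hv).hasDerivAt.hasFDerivAt)
    (hφ.continuousOn_fderiv.continuousAt (hD.mem_nhds hz))
    (by
      have h₁ : ContinuousAt (dt φ) z := hφ.continuousOn_dt.continuousAt (hD.mem_nhds hz)
      exact (ContinuousLinearMap.toSpanSingletonCLE (𝕜 := ℝ)
        (E := ℝ)).continuous.continuousAt.comp h₁)
  exact this.hasFDerivAt.differentiableAt

/-! ### The parabolic cylinder -/

theorem closure_cyl {n : ℕ} (Ω : Set (EuclideanSpace ℝ (Fin n))) :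
    closure (cyl Ω) = closure Ω ×ˢ Ici (0 : ℝ) := by
  rw [cyl, closure_prod_eq, closure_Ioi]

theorem isOpen_cyl {n : ℕ} {Ω : Set (EuclideanSpace ℝ (Fin n))} (hΩ : IsOpen Ω) :
    IsOpen (cyl Ω) :=
  hΩ.prod isOpen_Ioi

theorem mem_frontier_cyl {n : ℕ} {Ω : Set (EuclideanSpace ℝ (Fin n))} (hΩ : IsOpen Ω)
    {z : EuclideanSpace ℝ (Fin n) × ℝ} (hz : z ∈ closure (cyl Ω)) (hz' : z ∉ cyl Ω) :
    z ∈ frontier (cyl Ω) := by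
  rw [(isOpen_cyl hΩ).frontier_eq]
  exact ⟨hz, hz'⟩

/-! ### Power means -/

section PowerMean

variable {m : ℕ} {p : ℝ} {a w : Fin m → ℝ}

theorem sum_mul_rpow_nonneg (p : ℝ) (ha : ∀ i, 0 ≤ a i) (hw : ∀ i, 0 ≤ w i) :
    0 ≤ ∑ i, w i * a i ^ p :=
  Finset.sum_nonneg fun i _ => mul_nonneg (hw i) (Real.rpow_nonneg (ha i) p)

theorem powerMean_nonneg (p : ℝ) (ha : ∀ i, 0 ≤ a i) (hw : ∀ i, 0 ≤ w i) :
    0 ≤ powerMean p a w :=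
  Real.rpow_nonneg (sum_mul_rpow_nonneg p ha hw) _

theorem powerMean_rpow (hp : 0 < p) (ha : ∀ i, 0 ≤ a i) (hw : ∀ i, 0 ≤ w i) :
    powerMean p a w ^ p = ∑ i, w i * a i ^ p := by
  rw [powerMean, ← Real.rpow_mul (sum_mul_rpow_nonneg p ha hw), one_div_mul_cancel hp.ne',
    Real.rpow_one]

theorem powerMean_const (hp : 0 < p) {c : ℝ} (hc : 0 ≤ c) (hw : ∑ i, w i = 1) :
    powerMean p (fun _ => c) w = c := by
  rw [powerMean, ← Finset.sum_mul, hw, one_mul, ← Real.rpow_mul hc, mul_one_div_cancel hp.ne',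
    Real.rpow_one]

theorem powerMean_zero (hp : 0 < p) : powerMean p (fun _ => 0) w = 0 := by
  simp [powerMean, Real.zero_rpow hp.ne', hp.ne']

theorem continuous_powerMean (hp : 0 < p) (w : Fin m → ℝ) :
    Continuous fun a : Fin m → ℝ => powerMean p a w := by
  unfold powerMean
  refine Continuous.rpow_const ?_ fun _ => Or.inr (by positivity)
  exact continuous_finsetSum _ fun i _ =>
    continuous_const.mul ((continuous_apply i).rpow_const fun _ => Or.inr hp.le)

end PowerMean

theorem Weights.pos {m : ℕ} {w : Fin m → ℝ} (hw : w ∈ Weights m) (i : Fin m) : 0 < w i :=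
  (hw.1 i).1

theorem Weights.nonneg {m : ℕ} {w : Fin m → ℝ} (hw : w ∈ Weights m) (i : Fin m) : 0 ≤ w i :=
  (hw.1 i).1.le

/-! ### Competitors -/

/-- The point `(∑ wᵢ yᵢ, M_α(τ; w))` at which the points `(yᵢ, τᵢ)` compete for the envelope. -/
noncomputable def combine {n m : ℕ} (α : ℝ) (w : Fin m → ℝ) (ζ : Fin m → EuclideanSpace ℝ (Fin n) × ℝ) :
    EuclideanSpace ℝ (Fin n) × ℝ :=
  (∑ i, w i • (ζ i).1, powerMean α (fun i => (ζ i).2) w)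

theorem continuous_combine {n m : ℕ} {α : ℝ} (hα : 0 < α) (w : Fin m → ℝ) :
    Continuous (combine (n := n) α w) := by
  refine Continuous.prodMk (by fun_prop) ?_
  exact (continuous_powerMean hα w).comp (by fun_prop)

theorem combine_const {n m : ℕ} {α : ℝ} (hα : 0 < α) {w : Fin m → ℝ} (hw : ∑ i, w i = 1)
    {z : EuclideanSpace ℝ (Fin n) × ℝ} (hz : 0 ≤ z.2) : combine α w (fun _ => z) = z := by
  ext1
  · simp only [combine]
    rw [← Finset.sum_smul, hw, one_smul]
  · exact powerMean_const hα hz hw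

section Cylinder

variable {n m : ℕ} {Ω : Set (EuclideanSpace ℝ (Fin n))} {α : ℝ} {w : Fin m → ℝ}
  {ζ : Fin m → EuclideanSpace ℝ (Fin n) × ℝ}

theorem mem_closure_cyl {z : EuclideanSpace ℝ (Fin n) × ℝ} :
    z ∈ closure (cyl Ω) ↔ z.1 ∈ closure Ω ∧ 0 ≤ z.2 := by
  rw [closure_cyl]; rfl

theorem combine_mem_closure_cyl (hΩ : Convex ℝ Ω) (hw : w ∈ Weights m)
    (hζ : ∀ i, ζ i ∈ closure (cyl Ω)) : combine α w ζ ∈ closure (cyl Ω) := by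
  simp only [mem_closure_cyl] at hζ ⊢
  exact ⟨hΩ.closure.sum_mem (fun i _ => Weights.nonneg hw i) hw.2 fun i _ => (hζ i).1,
    powerMean_nonneg α (fun i => (hζ i).2) (Weights.nonneg hw)⟩

/-- A convex combination with positive weights of points of the closure lies in the open convex set
as soon as one of the points does. -/
theorem sum_smul_mem_of_mem {x : Fin m → EuclideanSpace ℝ (Fin n)} (hΩ : Convex ℝ Ω)
    (hΩo : IsOpen Ω) (hw : w ∈ Weights m) (hx : ∀ i, x i ∈ closure Ω) {j : Fin m}
    (hj : x j ∈ Ω) : ∑ i, w i • x i ∈ Ω := by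
  have hj1 : 0 < 1 - w j := by linarith [(hw.1 j).2]
  have hsum : w j + ∑ i ∈ Finset.univ.erase j, w i = 1 := by
    rw [Finset.add_sum_erase _ _ (Finset.mem_univ j), hw.2]
  have hrest : ∑ i ∈ Finset.univ.erase j, (w i / (1 - w j)) • x i ∈ closure Ω := by
    refine hΩ.closure.sum_mem (fun i _ => div_nonneg (Weights.nonneg hw i) hj1.le) ?_
      fun i _ => hx i
    rw [← Finset.sum_div, div_eq_one_iff_eq hj1.ne']
    linarith
  have := hΩ.combo_interior_closure_mem_interior (by rwa [hΩo.interior_eq]) hrest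
    (Weights.pos hw j) hj1.le (by ring)
  rw [hΩo.interior_eq, Finset.smul_sum] at this
  rw [← Finset.add_sum_erase _ _ (Finset.mem_univ j)]
  convert this using 3 with i
  rw [smul_smul, mul_div_cancel₀ _ hj1.ne']

theorem combine_mem_cyl (hΩ : Convex ℝ Ω) (hΩo : IsOpen Ω) (hw : w ∈ Weights m)
    (hζ : ∀ i, ζ i ∈ closure (cyl Ω)) {j : Fin m} (hj : ζ j ∈ cyl Ω) :
    combine α w ζ ∈ cyl Ω := by
  simp only [mem_closure_cyl] at hζ
  refine ⟨sum_smul_mem_of_mem hΩ hΩo hw (fun i => (hζ i).1) hj.1, ?_⟩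
  refine Real.rpow_pos_of_pos (Finset.sum_pos' (fun i _ => mul_nonneg (Weights.nonneg hw i)
    (Real.rpow_nonneg (hζ i).2 _)) ⟨j, Finset.mem_univ j, ?_⟩) _
  exact mul_pos (Weights.pos hw j) (Real.rpow_pos_of_pos hj.2 _)

theorem snd_le_of_combine (hα : 0 < α) (hw : w ∈ Weights m)
    (hζ : ∀ i, ζ i ∈ closure (cyl Ω)) {T : ℝ} (hT : (combine α w ζ).2 ≤ T) (i : Fin m) :
    (ζ i).2 ≤ (T ^ α / w i) ^ (1 / α) := by
  simp only [mem_closure_cyl] at hζ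
  have h0 : 0 ≤ (combine α w ζ).2 :=
    powerMean_nonneg α (fun i => (hζ i).2) (Weights.nonneg hw)
  have h₁ : w i * (ζ i).2 ^ α ≤ T ^ α := by
    calc w i * (ζ i).2 ^ α ≤ ∑ i, w i * (ζ i).2 ^ α :=
          Finset.single_le_sum (f := fun i => w i * (ζ i).2 ^ α) (fun i _ =>
            mul_nonneg (Weights.nonneg hw i) (Real.rpow_nonneg (hζ i).2 _)) (Finset.mem_univ i)
      _ = (combine α w ζ).2 ^ α :=
          (powerMean_rpow hα (fun i => (hζ i).2) (Weights.nonneg hw)).symm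
      _ ≤ T ^ α := Real.rpow_le_rpow h0 hT hα.le
  have h₂ : (ζ i).2 ^ α ≤ T ^ α / w i := by
    rw [le_div_iff₀ (Weights.pos hw i)]; linarith
  calc (ζ i).2 = ((ζ i).2 ^ α) ^ (1 / α) := by
        rw [← Real.rpow_mul (hζ i).2, mul_one_div_cancel hα.ne', Real.rpow_one]
    _ ≤ _ := Real.rpow_le_rpow (Real.rpow_nonneg (hζ i).2 _) h₂ (by positivity)

/-- Competitors for points of bounded time form a compact set: this is what makes suprema attained
and envelopes upper semicontinuous. -/
theorem isCompact_competitors (hΩb : Bornology.IsBounded Ω) (hα : 0 < α) (hw : w ∈ Weights m)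
    (T : ℝ) :
    IsCompact {ζ : Fin m → EuclideanSpace ℝ (Fin n) × ℝ |
      (∀ i, ζ i ∈ closure (cyl Ω)) ∧ (combine α w ζ).2 ≤ T} := by
  have hbox : IsCompact (univ.pi fun i : Fin m =>
      closure Ω ×ˢ Icc (0 : ℝ) ((T ^ α / w i) ^ (1 / α))) :=
    isCompact_univ_pi fun i => hΩb.isCompact_closure.prod isCompact_Icc
  refine hbox.of_isClosed_subset ?_ ?_
  · have hpi : IsClosed (univ.pi fun _ : Fin m => closure (cyl Ω)) :=
      isClosed_set_pi fun _ _ => isClosed_closure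
    convert hpi.inter (isClosed_le (continuous_combine hα w).snd (continuous_const (y := T)))
      using 1
    ext ζ
    simp
  · rintro ζ ⟨hζ, hT⟩ i -
    have hi := mem_closure_cyl.1 (hζ i)
    exact ⟨hi.1, hi.2, snd_le_of_combine hα hw hζ hT i⟩

end Cylinder

/-! ### Envelopes -/

section Envelope

variable {n : ℕ} {Ω : Set (EuclideanSpace ℝ (Fin n))} {α p : ℝ} {w : Fin (n + 1) → ℝ}
  {u : EuclideanSpace ℝ (Fin n) × ℝ → ℝ} {z : EuclideanSpace ℝ (Fin n) × ℝ}

theorem envelopeValues_eq_image (Ω : Set (EuclideanSpace ℝ (Fin n))) (α p : ℝ)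
    (w : Fin (n + 1) → ℝ) (u : EuclideanSpace ℝ (Fin n) × ℝ → ℝ)
    (z : EuclideanSpace ℝ (Fin n) × ℝ) :
    envelopeValues Ω α p w u z = (fun ζ : Fin (n + 1) → EuclideanSpace ℝ (Fin n) × ℝ =>
      powerMean p (fun i => u (ζ i)) w) ''
        {ζ | (∀ i, ζ i ∈ closure (cyl Ω)) ∧ combine α w ζ = z} := by
  ext r
  constructor
  · rintro ⟨ζ, h₁, h₂, h₃, h₄⟩
    exact ⟨ζ, ⟨h₁, Prod.ext h₂.symm h₃.symm⟩, h₄.symm⟩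
  · rintro ⟨ζ, ⟨h₁, rfl⟩, rfl⟩
    exact ⟨ζ, h₁, rfl, rfl, rfl⟩

theorem continuousOn_powerMean_comp (hp : 0 < p) (huc : ContinuousOn u (closure (cyl Ω))) :
    ContinuousOn (fun ζ : Fin (n + 1) → EuclideanSpace ℝ (Fin n) × ℝ =>
      powerMean p (fun i => u (ζ i)) w) {ζ | ∀ i, ζ i ∈ closure (cyl Ω)} := by
  refine (continuous_powerMean hp w).comp_continuousOn (continuousOn_pi.2 fun i => ?_)
  exact huc.comp (continuous_apply i).continuousOn fun ζ hζ => hζ i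

theorem isCompact_envelopeValues (hΩb : Bornology.IsBounded Ω) (hα : 0 < α) (hp : 0 < p)
    (hw : w ∈ Weights (n + 1)) (huc : ContinuousOn u (closure (cyl Ω)))
    (z : EuclideanSpace ℝ (Fin n) × ℝ) : IsCompact (envelopeValues Ω α p w u z) := by
  rw [envelopeValues_eq_image]
  refine IsCompact.image_of_continuousOn ?_
    ((continuousOn_powerMean_comp hp huc).mono fun ζ hζ => hζ.1)
  have : {ζ : Fin (n + 1) → EuclideanSpace ℝ (Fin n) × ℝ |
      (∀ i, ζ i ∈ closure (cyl Ω)) ∧ combine α w ζ = z} =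
      {ζ | (∀ i, ζ i ∈ closure (cyl Ω)) ∧ (combine α w ζ).2 ≤ z.2} ∩ combine α w ⁻¹' {z} := by
    ext ζ
    constructor
    · rintro ⟨h₁, h₂⟩
      exact ⟨⟨h₁, by rw [h₂]⟩, h₂⟩
    · rintro ⟨⟨h₁, -⟩, h₂⟩
      exact ⟨h₁, h₂⟩
  rw [this]
  exact (isCompact_competitors hΩb hα hw _).inter_right
    (isClosed_singleton.preimage (continuous_combine hα w))

theorem powerMean_le_lambdaEnvelope (hbdd : BddAbove (envelopeValues Ω α p w u z))
    {ζ : Fin (n + 1) → EuclideanSpace ℝ (Fin n) × ℝ} (hζ : ∀ i, ζ i ∈ closure (cyl Ω))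
    (hz : combine α w ζ = z) : powerMean p (fun i => u (ζ i)) w ≤ lambdaEnvelope Ω α p w u z := by
  refine le_csSup hbdd ?_
  rw [envelopeValues_eq_image]
  exact ⟨ζ, ⟨hζ, hz⟩, rfl⟩

theorem exists_eq_lambdaEnvelope (hΩb : Bornology.IsBounded Ω) (hα : 0 < α) (hp : 0 < p)
    (hw : w ∈ Weights (n + 1)) (huc : ContinuousOn u (closure (cyl Ω)))
    (hz : z ∈ closure (cyl Ω)) :
    ∃ ζ : Fin (n + 1) → EuclideanSpace ℝ (Fin n) × ℝ, (∀ i, ζ i ∈ closure (cyl Ω)) ∧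
      combine α w ζ = z ∧ powerMean p (fun i => u (ζ i)) w = lambdaEnvelope Ω α p w u z := by
  have hmem := (isCompact_envelopeValues hΩb hα hp hw huc z).sSup_mem (by
    rw [envelopeValues_eq_image]
    exact Nonempty.image _ ⟨fun _ => z, fun _ => hz,
      combine_const hα hw.2 (mem_closure_cyl.1 hz).2⟩)
  rw [envelopeValues_eq_image] at hmem
  obtain ⟨ζ, ⟨h₁, h₂⟩, h₃⟩ := hmem
  refine ⟨ζ, h₁, h₂, h₃.trans ?_⟩
  rw [← envelopeValues_eq_image]
  rfl

theorem le_lambdaEnvelope (hΩb : Bornology.IsBounded Ω) (hα : 0 < α) (hp : 0 < p)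
    (hw : w ∈ Weights (n + 1)) (huc : ContinuousOn u (closure (cyl Ω)))
    (hz : z ∈ closure (cyl Ω)) (huz : 0 ≤ u z) : u z ≤ lambdaEnvelope Ω α p w u z := by
  have := powerMean_le_lambdaEnvelope (p := p)
    (isCompact_envelopeValues hΩb hα hp hw huc z).bddAbove
    (fun _ => hz) (combine_const hα hw.2 (mem_closure_cyl.1 hz).2)
  rwa [powerMean_const hp huz hw.2] at this

theorem lambdaEnvelope_eq_zero (hΩo : IsOpen Ω) (hΩc : Convex ℝ Ω)
    (hΩb : Bornology.IsBounded Ω) (hα : 0 < α) (hp : 0 < p) (hw : w ∈ Weights (n + 1))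
    (huc : ContinuousOn u (closure (cyl Ω))) (hu0 : ∀ z ∈ frontier (cyl Ω), u z = 0)
    (hz : z ∈ frontier (cyl Ω)) : lambdaEnvelope Ω α p w u z = 0 := by
  rw [(isOpen_cyl hΩo).frontier_eq] at hz
  obtain ⟨ζ, h₁, h₂, h₃⟩ := exists_eq_lambdaEnvelope hΩb hα hp hw huc hz.1
  have hζ : ∀ i, u (ζ i) = 0 := fun i =>
    hu0 _ (mem_frontier_cyl hΩo (h₁ i) fun hi => hz.2 (h₂ ▸ combine_mem_cyl hΩc hΩo hw h₁ hi))
  rw [← h₃]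
  simp only [hζ]
  exact powerMean_zero hp

/-- Superlevel sets of the envelope are images of compact sets of competitors. -/
theorem upperSemicontinuousOn_lambdaEnvelope (hΩb : Bornology.IsBounded Ω)
    (hα : 0 < α) (hp : 0 < p) (hw : w ∈ Weights (n + 1))
    (huc : ContinuousOn u (closure (cyl Ω))) :
    UpperSemicontinuousOn (lambdaEnvelope Ω α p w u) (closure (cyl Ω)) := by
  intro z₀ hz₀ c hc
  set S : Set (Fin (n + 1) → EuclideanSpace ℝ (Fin n) × ℝ) :=
    {ζ | (∀ i, ζ i ∈ closure (cyl Ω)) ∧ (combine α w ζ).2 ≤ z₀.2 + 1} with hS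
  have hScomp : IsCompact S := isCompact_competitors hΩb hα hw _
  have hS' : IsCompact (S ∩ (fun ζ => powerMean p (fun i => u (ζ i)) w) ⁻¹' Ici c) :=
    hScomp.of_isClosed_subset (((continuousOn_powerMean_comp hp huc).mono
      fun ζ hζ => hζ.1).preimage_isClosed_of_isClosed hScomp.isClosed isClosed_Ici)
      inter_subset_left
  have himg := (hS'.image (continuous_combine hα w)).isClosed
  have hz₀' : z₀ ∉ combine α w '' (S ∩ (fun ζ => powerMean p (fun i => u (ζ i)) w) ⁻¹' Ici c) := by
    rintro ⟨ζ, ⟨⟨h₁, -⟩, h₃⟩, h₄⟩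
    exact absurd (hc.trans_le h₃) (not_lt.2 (powerMean_le_lambdaEnvelope
      (isCompact_envelopeValues hΩb hα hp hw huc z₀).bddAbove h₁ h₄))
  have htime : ∀ᶠ z in 𝓝 z₀, z.2 < z₀.2 + 1 :=
    continuous_snd.continuousAt.eventually_lt_const (lt_add_one _)
  filter_upwards [self_mem_nhdsWithin, mem_nhdsWithin_of_mem_nhds (himg.isOpen_compl.mem_nhds hz₀'),
    mem_nhdsWithin_of_mem_nhds htime] with z hz hzc hzt
  by_contra! hle
  obtain ⟨ζ, h₁, h₂, h₃⟩ := exists_eq_lambdaEnvelope hΩb hα hp hw huc hz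
  exact hzc ⟨ζ, ⟨⟨h₁, by rw [h₂]; exact le_of_lt hzt⟩, by rw [mem_preimage, h₃]; exact hle⟩,
    h₂⟩

end Envelope

/-! ### Perturbing competitors -/

/-- The competitors `ζ`, moved by `h` in space and by `δ` in the variable `τ ^ α`, in which the
constraint on the times is affine. -/
noncomputable def shift {n m : ℕ} (α : ℝ) (ζ : Fin m → EuclideanSpace ℝ (Fin n) × ℝ)
    (h : Fin m → EuclideanSpace ℝ (Fin n)) (δ : Fin m → ℝ) (k : Fin m) :
    EuclideanSpace ℝ (Fin n) × ℝ :=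
  ((ζ k).1 + h k, ((ζ k).2 ^ α + δ k) ^ (1 / α))

section Shift

variable {n m : ℕ} {α : ℝ} {w : Fin m → ℝ} {ζ : Fin m → EuclideanSpace ℝ (Fin n) × ℝ}
  {h : Fin m → EuclideanSpace ℝ (Fin n)} {δ : Fin m → ℝ}

theorem shift_of_eq_zero (hα : 0 < α) {k : Fin m} (hk : 0 ≤ (ζ k).2) (hh : h k = 0)
    (hδ : δ k = 0) : shift α ζ h δ k = ζ k := by
  ext1
  · simp [shift, hh]
  · simp only [shift, hδ, add_zero]
    rw [← Real.rpow_mul hk, mul_one_div_cancel hα.ne', Real.rpow_one]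

/-- The condition on `δ` keeps the shifted quantities `τ ^ α` nonnegative, away from the junk values of
real powers. -/
theorem combine_shift (hα : 0 < α) (hζ : ∀ k, 0 ≤ (ζ k).2) (hw : ∀ k, 0 ≤ w k)
    (hδ : ∀ k, 0 ≤ (ζ k).2 ^ α + δ k) :
    combine α w (shift α ζ h δ) = ((combine α w ζ).1 + ∑ k, w k • h k,
      ((combine α w ζ).2 ^ α + ∑ k, w k * δ k) ^ (1 / α)) := by
  ext1
  · simp only [combine, shift, smul_add, Finset.sum_add_distrib]
  · have : (combine α w ζ).2 ^ α = ∑ k, w k * (ζ k).2 ^ α := powerMean_rpow hα hζ hw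
    simp only [this]
    simp only [combine, shift, powerMean]
    rw [← Finset.sum_add_distrib]
    congr 1
    refine Finset.sum_congr rfl fun k _ => ?_
    rw [← Real.rpow_mul (hδ k), one_div_mul_cancel hα.ne', Real.rpow_one, mul_add]

end Shift

/-! ### Monotonicity in time and positivity -/

section Solution

variable {n : ℕ} {Ω : Set (EuclideanSpace ℝ (Fin n))}
  {f : EuclideanSpace ℝ (Fin n) → ℝ → ℝ → EuclideanSpace ℝ (Fin n) → ℝ}
  {u : EuclideanSpace ℝ (Fin n) × ℝ → ℝ} {p α : ℝ}

theorem monotoneOn_time (hΩo : IsOpen Ω) (hu : IsClassicalSolution Ω f u)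
    (hu0 : ∀ z ∈ frontier (cyl Ω), u z = 0) (hmono : ∀ z ∈ cyl Ω, 0 ≤ dt u z)
    {x : EuclideanSpace ℝ (Fin n)} (hx : x ∈ closure Ω) :
    MonotoneOn (fun t : ℝ => u (x, t)) (Ici 0) := by
  by_cases hxΩ : x ∈ Ω
  · refine monotoneOn_of_deriv_nonneg (convex_Ici 0) ?_ ?_ ?_
    · exact hu.continuousOn_closure.comp (by fun_prop) fun t ht => mem_closure_cyl.2 ⟨hx, ht⟩
    · rw [interior_Ici]
      exact fun t ht => (hu.c21.differentiableAt_time (x, t) ⟨hxΩ, ht⟩).differentiableWithinAt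
    · rw [interior_Ici]
      exact fun t ht => hmono (x, t) ⟨hxΩ, ht⟩
  · have hzero : ∀ t ∈ Ici (0 : ℝ), u (x, t) = 0 := fun t ht =>
      hu0 _ (mem_frontier_cyl hΩo (mem_closure_cyl.2 ⟨hx, ht⟩) fun h => hxΩ h.1)
    intro s hs t ht _
    simp only [hzero s hs, hzero t ht, le_refl]

theorem nonneg_of_mem_closure_cyl (hΩo : IsOpen Ω) (hu : IsClassicalSolution Ω f u)
    (hu0 : ∀ z ∈ frontier (cyl Ω), u z = 0) (hmono : ∀ z ∈ cyl Ω, 0 ≤ dt u z)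
    {z : EuclideanSpace ℝ (Fin n) × ℝ} (hz : z ∈ closure (cyl Ω)) : 0 ≤ u z := by
  obtain ⟨hx, ht⟩ := mem_closure_cyl.1 hz
  have h0 : u (z.1, 0) = 0 :=
    hu0 _ (mem_frontier_cyl hΩo (mem_closure_cyl.2 ⟨hx, le_rfl⟩) fun h => lt_irrefl (0 : ℝ) h.2)
  have := monotoneOn_time hΩo hu hu0 hmono hx (mem_Ici.2 le_rfl) ht ht
  simpa [h0] using this

/-- The growth condition at an interior point makes `u` positive for small times, and `u` does not
decrease afterwards. -/
theorem pos_of_mem_cyl (hΩo : IsOpen Ω) (hp : 0 < p) (hα : 0 < α)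
    (hu : IsClassicalSolution Ω f u)
    (hu0 : ∀ z ∈ frontier (cyl Ω), u z = 0) (hmono : ∀ z ∈ cyl Ω, 0 ≤ dt u z)
    (hgrowth : ∀ x ∈ closure Ω, ∀ y ∈ Ω,
      Tendsto (fun ρ : ℝ => u (x + ρ • direction x y, ρ ^ (1 / α)) ^ p / ρ) (𝓝[>] 0) atTop)
    {z : EuclideanSpace ℝ (Fin n) × ℝ} (hz : z ∈ cyl Ω) : 0 < u z := by
  have hx := subset_closure hz.1
  have ht : (0 : ℝ) < z.2 := hz.2
  have hsmall : ∀ᶠ ρ : ℝ in 𝓝[>] 0, ρ < z.2 ^ α :=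
    mem_nhdsWithin_of_mem_nhds (Iio_mem_nhds (Real.rpow_pos_of_pos ht α))
  obtain ⟨ρ, hρ, hρz, hρ0⟩ := ((hgrowth z.1 hx z.1 hz.1).eventually_gt_atTop 0 |>.and
    (hsmall.and self_mem_nhdsWithin)).exists
  replace hρ0 : 0 < ρ := hρ0
  simp only [direction, sub_self, smul_zero, add_zero] at hρ
  have hρt : ρ ^ (1 / α) ≤ z.2 := by
    calc ρ ^ (1 / α) ≤ (z.2 ^ α) ^ (1 / α) := Real.rpow_le_rpow hρ0.le hρz.le (by positivity)
      _ = z.2 := by rw [← Real.rpow_mul ht.le, mul_one_div_cancel hα.ne', Real.rpow_one]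
  have hρ1 : (0 : ℝ) ≤ ρ ^ (1 / α) := Real.rpow_nonneg hρ0.le _
  have hle := monotoneOn_time hΩo hu hu0 hmono hx hρ1 ht.le hρt
  have hnn := nonneg_of_mem_closure_cyl hΩo hu hu0 hmono
    (mem_closure_cyl.2 ⟨hx, hρ1⟩ : (z.1, ρ ^ (1 / α)) ∈ closure (cyl Ω))
  refine lt_of_lt_of_le (hnn.lt_of_ne fun h0 => ?_) hle
  rw [← h0, Real.zero_rpow hp.ne', zero_div] at hρ
  exact lt_irrefl _ hρ

theorem eventually_add_direction_mem_closure (hΩ : Convex ℝ Ω) {x y : EuclideanSpace ℝ (Fin n)}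
    (hx : x ∈ closure Ω) (hy : y ∈ closure Ω) :
    ∀ᶠ ρ : ℝ in 𝓝[>] 0, x + ρ • direction x y ∈ closure Ω := by
  rcases eq_or_ne y x with rfl | hxy
  · simp [direction, hx]
  have hpos : 0 < ‖y - x‖ := norm_pos_iff.2 (sub_ne_zero.2 hxy)
  filter_upwards [self_mem_nhdsWithin, mem_nhdsWithin_of_mem_nhds (Iio_mem_nhds hpos)] with ρ h₁ h₂
  rw [direction, smul_smul, ← div_eq_mul_inv]
  exact hΩ.closure.add_smul_sub_mem hx hy
    ⟨div_nonneg (le_of_lt h₁) hpos.le, (div_le_one hpos).2 (le_of_lt h₂)⟩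

/-! ### Competitors realizing the envelope -/

/-- Competitors realizing the envelope at a point of `D` lie in `D`. If one of them were on the
boundary, moving it by `ρ` towards one at which `u > 0`, and moving the latter back so as to keep
the constraints, would gain more than any multiple of `ρ` by the growth condition, and lose only
`O(ρ)`. -/
theorem mem_cyl_of_eq_lambdaEnvelope (hΩo : IsOpen Ω) (hΩ : Convex ℝ Ω)
    (hΩb : Bornology.IsBounded Ω) (hp : 0 < p) (hα : 0 < α)
    (hu : IsClassicalSolution Ω f u)
    (hu0 : ∀ z ∈ frontier (cyl Ω), u z = 0) (hmono : ∀ z ∈ cyl Ω, 0 ≤ dt u z)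
    (hgrowth : ∀ x ∈ closure Ω, ∀ y ∈ Ω,
      Tendsto (fun ρ : ℝ => u (x + ρ • direction x y, ρ ^ (1 / α)) ^ p / ρ) (𝓝[>] 0) atTop)
    {w : Fin (n + 1) → ℝ} (hw : w ∈ Weights (n + 1))
    {z : EuclideanSpace ℝ (Fin n) × ℝ} (hz : z ∈ cyl Ω)
    {ζ : Fin (n + 1) → EuclideanSpace ℝ (Fin n) × ℝ} (hζ : ∀ i, ζ i ∈ closure (cyl Ω))
    (hζz : combine α w ζ = z)
    (hmax : powerMean p (fun i => u (ζ i)) w = lambdaEnvelope Ω α p w u z) (i : Fin (n + 1)) :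
    ζ i ∈ cyl Ω := by
  have hnn : ∀ {z}, z ∈ closure (cyl Ω) → 0 ≤ u z :=
    fun h => nonneg_of_mem_closure_cyl hΩo hu hu0 hmono h
  have hζ2 : ∀ k, 0 ≤ (ζ k).2 := fun k => (mem_closure_cyl.1 (hζ k)).2
  have hbdd := (isCompact_envelopeValues hΩb hα hp hw hu.continuousOn_closure z).bddAbove
  by_contra hi
  have hui : u (ζ i) = 0 := hu0 _ (mem_frontier_cyl hΩo (hζ i) hi)
  obtain ⟨j, hj⟩ : ∃ j, ζ j ∈ cyl Ω := by
    by_contra! hall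
    have hzero : ∀ k, u (ζ k) = 0 := fun k => hu0 _ (mem_frontier_cyl hΩo (hζ k) (hall k))
    have hpos := (pos_of_mem_cyl hΩo hp hα hu hu0 hmono hgrowth hz).trans_le
      (le_lambdaEnvelope hΩb hα hp hw hu.continuousOn_closure (subset_closure hz)
        (hnn (subset_closure hz)))
    rw [← hmax] at hpos
    simp only [hzero, powerMean_zero hp] at hpos
    exact lt_irrefl _ hpos
  have hij : i ≠ j := by
    rintro rfl
    exact hi hj
  have huj : 0 < u (ζ j) := pos_of_mem_cyl hΩo hp hα hu hu0 hmono hgrowth hj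
  have hτj : 0 < (ζ j).2 := hj.2
  set c := w i / w j with hc
  have hcpos : 0 < c := div_pos (Weights.pos hw i) (Weights.pos hw j)
  set ν := direction (ζ i).1 (ζ j).1 with hν
  let δ : ℝ → Fin (n + 1) → ℝ := fun ρ k => if k = i then ρ else if k = j then -(c * ρ) else 0
  have hδi : ∀ ρ, δ ρ i = ρ := fun ρ => by simp [δ]
  have hδj : ∀ ρ, δ ρ j = -(c * ρ) := fun ρ => by simp [δ, hij.symm]
  have hδk : ∀ ρ k, k ≠ i ∧ k ≠ j → δ ρ k = 0 := fun ρ k hk => by simp [δ, hk.1, hk.2]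
  have hδsum : ∀ ρ, ∑ k, w k * δ ρ k = 0 := by
    intro ρ
    rw [Fintype.sum_eq_add i j hij fun k hk => by rw [hδk ρ k hk, mul_zero], hδi, hδj, hc]
    field_simp [(Weights.pos hw j).ne']
    ring
  let Z : ℝ → Fin (n + 1) → EuclideanSpace ℝ (Fin n) × ℝ :=
    fun ρ => shift α ζ (fun k => δ ρ k • ν) (δ ρ)
  have hZk : ∀ ρ k, k ≠ i ∧ k ≠ j → Z ρ k = ζ k := fun ρ k hk =>
    shift_of_eq_zero hα (hζ2 k) (by rw [hδk ρ k hk, zero_smul]) (hδk ρ k hk)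
  have hZ0 : Z 0 j = ζ j :=
    shift_of_eq_zero hα (hζ2 j) (by rw [hδj]; simp) (by rw [hδj]; simp)
  -- the point `Z ρ j` depends differentiably on `ρ`, so that the loss is `O(ρ)`
  have hZj : DifferentiableAt ℝ (fun ρ => Z ρ j) 0 := by
    have : (fun ρ => Z ρ j) = fun ρ =>
        ((ζ j).1 + (-(c * ρ)) • ν, ((ζ j).2 ^ α + -(c * ρ)) ^ (1 / α)) := by
      ext1 ρ
      simp only [Z, shift, hδj]
    rw [this]
    refine DifferentiableAt.prodMk (by fun_prop) ?_
    refine DifferentiableAt.rpow_const (by fun_prop) (Or.inl ?_)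
    simpa using (Real.rpow_pos_of_pos hτj α).ne'
  have hloss : DifferentiableAt ℝ (fun ρ => u (Z ρ j) ^ p) 0 := by
    refine DifferentiableAt.rpow_const ?_ (Or.inl (by rw [hZ0]; exact huj.ne'))
    have hdu : DifferentiableAt ℝ u (Z 0 j) := by
      rw [hZ0]
      exact hu.c21.differentiableAt (isOpen_cyl hΩo) hj
    exact hdu.comp (0 : ℝ) hZj
  obtain ⟨C, hC⟩ := hloss.isBigO_sub.bound
  have hgain := (hgrowth (ζ i).1 (mem_closure_cyl.1 (hζ i)).1 (ζ j).1 hj.1).eventually_gt_atTop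
    (C / c)
  have hZjmem : ∀ᶠ ρ in 𝓝 (0 : ℝ), Z ρ j ∈ cyl Ω :=
    hZj.continuousAt.eventually_mem ((isOpen_cyl hΩo).mem_nhds (by rw [hZ0]; exact hj))
  have hτ : ∀ᶠ ρ in 𝓝 (0 : ℝ), 0 ≤ (ζ j).2 ^ α + -(c * ρ) := by
    have : ContinuousAt (fun ρ : ℝ => (ζ j).2 ^ α + -(c * ρ)) 0 := by fun_prop
    filter_upwards [this.eventually_const_lt (u := 0)
      (by simpa using Real.rpow_pos_of_pos hτj α)] with ρ hρ using hρ.le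
  obtain ⟨ρ, hρ0, hρC, hρg, hρj, hρτ, hρi⟩ := (eventually_mem_nhdsWithin.and
    ((hC.filter_mono nhdsWithin_le_nhds).and (hgain.and
      ((hZjmem.filter_mono nhdsWithin_le_nhds).and ((hτ.filter_mono nhdsWithin_le_nhds).and (eventually_add_direction_mem_closure hΩ
        (mem_closure_cyl.1 (hζ i)).1 (subset_closure hj.1))))))).exists
  replace hρ0 : 0 < ρ := hρ0
  have hδnn : ∀ k, 0 ≤ (ζ k).2 ^ α + δ ρ k := by
    intro k
    by_cases hki : k = i
    · rw [hki, hδi]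
      exact add_nonneg (Real.rpow_nonneg (hζ2 i) _) hρ0.le
    by_cases hkj : k = j
    · rwa [hkj, hδj]
    · rw [hδk ρ k ⟨hki, hkj⟩, add_zero]
      exact Real.rpow_nonneg (hζ2 k) _
  have hZmem : ∀ k, Z ρ k ∈ closure (cyl Ω) := by
    intro k
    by_cases hki : k = i
    · rw [hki]
      refine mem_closure_cyl.2 ⟨?_, Real.rpow_nonneg (hδnn i) _⟩
      simp only [Z, shift, hδi]
      exact hρi
    by_cases hkj : k = j
    · rw [hkj]
      exact subset_closure hρj
    · rw [hZk ρ k ⟨hki, hkj⟩]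
      exact hζ k
  have hZz : combine α w (Z ρ) = z := by
    have h2 : 0 ≤ (combine α w ζ).2 := hζz ▸ (le_of_lt hz.2)
    rw [combine_shift hα hζ2 (Weights.nonneg hw) hδnn, hδsum, add_zero, ← Real.rpow_mul h2,
      mul_one_div_cancel hα.ne', Real.rpow_one, ← hζz]
    simp only [smul_smul]
    rw [← Finset.sum_smul, hδsum, zero_smul, add_zero]
  have hle := powerMean_le_lambdaEnvelope (p := p) hbdd hZmem hZz
  rw [← hmax] at hle
  have hle' := Real.rpow_le_rpow
    (powerMean_nonneg p (fun k => hnn (hZmem k)) (Weights.nonneg hw)) hle hp.le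
  rw [powerMean_rpow hp (fun k => hnn (hZmem k)) (Weights.nonneg hw),
    powerMean_rpow hp (fun k => hnn (hζ k)) (Weights.nonneg hw), ← sub_nonpos,
    ← Finset.sum_sub_distrib, Fintype.sum_eq_add i j hij fun k hk => by rw [hZk ρ k hk, sub_self],
    hui, Real.zero_rpow hp.ne', mul_zero, sub_zero, ← mul_sub] at hle'
  have hgain' : C * ρ < c * u (Z ρ i) ^ p := by
    rw [lt_div_iff₀ hρ0, div_mul_eq_mul_div, div_lt_iff₀ hcpos] at hρg
    refine hρg.trans_le ?_
    rw [mul_comm]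
    refine mul_le_mul_of_nonneg_left (Real.rpow_le_rpow (hnn (mem_closure_cyl.2
      ⟨hρi, Real.rpow_nonneg hρ0.le _⟩)) ?_ hp.le) hcpos.le
    have hZi : Z ρ i = ((ζ i).1 + ρ • ν, ((ζ i).2 ^ α + ρ) ^ (1 / α)) := by
      simp only [Z, shift, hδi]
    rw [hZi]
    refine monotoneOn_time hΩo hu hu0 hmono hρi (mem_Ici.2 (Real.rpow_nonneg hρ0.le _))
      (mem_Ici.2 (Real.rpow_nonneg (by rw [← hδi ρ]; simpa [hδi] using hδnn i) _))
      (Real.rpow_le_rpow hρ0.le ?_ (by positivity))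
    linarith [Real.rpow_nonneg (hζ2 i) α]
  rw [hZ0, Real.norm_eq_abs, sub_zero, Real.norm_eq_abs, abs_of_pos hρ0] at hρC
  have hloss' : -(C * ρ) ≤ u (Z ρ j) ^ p - u (ζ j) ^ p := by
    linarith [neg_abs_le (u (Z ρ j) ^ p - u (ζ j) ^ p)]
  have hwi : w i = w j * c := by
    rw [hc, mul_div_cancel₀ _ (Weights.pos hw j).ne']
  rw [hwi, mul_assoc, ← mul_add] at hle'
  have hpos : 0 < w j * (c * u (Z ρ i) ^ p + (u (Z ρ j) ^ p - u (ζ j) ^ p)) :=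
    mul_pos (Weights.pos hw j) (by linarith)
  exact absurd hle' (not_le.2 hpos)

/-- Competitors realizing the envelope at `z₀` in `D` lie in `D`, hence can be translated along
with the point: this bounds the envelope near `z₀` from below. On the boundary it vanishes. -/
theorem continuousOn_lambdaEnvelope (hΩo : IsOpen Ω) (hΩ : Convex ℝ Ω)
    (hΩb : Bornology.IsBounded Ω) (hp : 0 < p) (hα : 0 < α)
    (hu : IsClassicalSolution Ω f u)
    (hu0 : ∀ z ∈ frontier (cyl Ω), u z = 0) (hmono : ∀ z ∈ cyl Ω, 0 ≤ dt u z)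
    (hgrowth : ∀ x ∈ closure Ω, ∀ y ∈ Ω,
      Tendsto (fun ρ : ℝ => u (x + ρ • direction x y, ρ ^ (1 / α)) ^ p / ρ) (𝓝[>] 0) atTop)
    {w : Fin (n + 1) → ℝ} (hw : w ∈ Weights (n + 1)) :
    ContinuousOn (lambdaEnvelope Ω α p w u) (closure (cyl Ω)) := by
  have huc := hu.continuousOn_closure
  have hnn : ∀ z ∈ closure (cyl Ω), 0 ≤ lambdaEnvelope Ω α p w u z := fun z hz =>
    (nonneg_of_mem_closure_cyl hΩo hu hu0 hmono hz).trans (le_lambdaEnvelope hΩb hα hp hw huc hz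
      (nonneg_of_mem_closure_cyl hΩo hu hu0 hmono hz))
  rw [continuousOn_iff_lower_upperSemicontinuousOn]
  refine ⟨fun z₀ hz₀ c hc => ?_, upperSemicontinuousOn_lambdaEnvelope hΩb hα hp hw huc⟩
  change c < lambdaEnvelope Ω α p w u z₀ at hc
  change ∀ᶠ z in 𝓝[closure (cyl Ω)] z₀, c < lambdaEnvelope Ω α p w u z
  by_cases hzD : z₀ ∈ cyl Ω
  swap
  · rw [lambdaEnvelope_eq_zero hΩo hΩ hΩb hα hp hw huc hu0 (mem_frontier_cyl hΩo hz₀ hzD)] at hc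
    filter_upwards [self_mem_nhdsWithin] with z hz using hc.trans_le (hnn z hz)
  obtain ⟨ζ, hζ, hζz, hmax⟩ := exists_eq_lambdaEnvelope hΩb hα hp hw huc hz₀
  have hζD := mem_cyl_of_eq_lambdaEnvelope hΩo hΩ hΩb hp hα hu hu0 hmono hgrowth hw hzD hζ hζz hmax
  have hζ2 : ∀ k, 0 < (ζ k).2 := fun k => (hζD k).2
  have hz2 : (0 : ℝ) < z₀.2 := hzD.2
  let Z : EuclideanSpace ℝ (Fin n) × ℝ → Fin (n + 1) → EuclideanSpace ℝ (Fin n) × ℝ :=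
    fun z => shift α ζ (fun _ => z.1 - z₀.1) (fun _ => z.2 ^ α - z₀.2 ^ α)
  have hZ0 : Z z₀ = ζ := by
    ext1 k
    exact shift_of_eq_zero hα (hζ2 k).le (sub_self _) (sub_self _)
  have hpow : ContinuousAt (fun z : EuclideanSpace ℝ (Fin n) × ℝ => z.2 ^ α - z₀.2 ^ α) z₀ :=
    (continuousAt_snd.rpow_const (Or.inl hz2.ne')).sub continuousAt_const
  have hZc : ContinuousAt Z z₀ := by
    refine continuousAt_pi.2 fun k => ContinuousAt.prodMk (by fun_prop) ?_
    exact (continuousAt_const.add hpow).rpow_const (Or.inr (by positivity))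
  have hZD : ∀ᶠ z in 𝓝 z₀, ∀ k, Z z k ∈ cyl Ω := eventually_all.2 fun k =>
    (continuousAt_pi.1 hZc k).eventually_mem ((isOpen_cyl hΩo).mem_nhds (by rw [hZ0]; exact hζD k))
  have hδ : ∀ᶠ z in 𝓝 z₀, ∀ k, 0 ≤ (ζ k).2 ^ α + (z.2 ^ α - z₀.2 ^ α) := eventually_all.2 fun k => by
    filter_upwards [(continuousAt_const.add hpow).eventually_const_lt (u := 0)
      (by simpa using Real.rpow_pos_of_pos (hζ2 k) α)] with z hz using hz.le
  have hF : ContinuousAt (fun z => powerMean p (fun i => u (Z z i)) w) z₀ := by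
    have : ∀ k, ContinuousAt (fun z => u (Z z k)) z₀ := fun k => by
      have huk : ContinuousAt u (Z z₀ k) := by
        rw [hZ0]
        exact hu.c21.continuousOn.continuousAt ((isOpen_cyl hΩo).mem_nhds (hζD k))
      exact ContinuousAt.comp (f := fun z => Z z k) huk (continuousAt_pi.1 hZc k)
    exact (continuous_powerMean hp w).continuousAt.comp (continuousAt_pi.2 this)
  rw [← hmax] at hc
  have hFc := hF.eventually_const_lt (u := c) (by simpa only [hZ0] using hc)
  filter_upwards [self_mem_nhdsWithin, nhdsWithin_le_nhds hZD, nhdsWithin_le_nhds hδ,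
    nhdsWithin_le_nhds hFc] with z hz hzD' hzδ hzc
  refine hzc.trans_le (powerMean_le_lambdaEnvelope
    (isCompact_envelopeValues hΩb hα hp hw huc z).bddAbove (fun k => subset_closure (hzD' k)) ?_)
  have ht := (mem_closure_cyl.1 hz).2
  rw [combine_shift hα (fun k => (hζ2 k).le) (Weights.nonneg hw) hzδ, hζz, ← Finset.sum_smul,
    ← Finset.sum_mul, hw.2, one_smul, one_mul, add_sub_cancel, add_sub_cancel, ← Real.rpow_mul ht,
    mul_one_div_cancel hα.ne', Real.rpow_one]

end Solution

/-! ### First and second order conditions in space -/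

section Space

variable {E : Type*} [NormedAddCommGroup E] [NormedSpace ℝ E] {m : ℕ} {p : ℝ} {w : Fin m → ℝ}
  {P : E → ℝ} {H : Fin m → E → ℝ} {x : E} {y : Fin m → E}

theorem rpow_mul_fderiv_eq_of_isLocalMin (hp : 0 < p) (hw : ∀ i, 0 < w i)
    (hP : DifferentiableAt ℝ P x) (hPpos : 0 < P x)
    (hH : ∀ i, DifferentiableAt ℝ (H i) (y i)) (hHpos : ∀ i, 0 < H i (y i))
    (hmin : ∀ (c : Fin m → ℝ) (e : E), IsLocalMin (fun r : ℝ =>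
      P (x + r • ((∑ i, w i * c i) • e)) ^ p - ∑ i, w i * H i (y i + r • (c i • e)) ^ p) 0)
    (k : Fin m) (e : E) :
    P x ^ (p - 1) * fderiv ℝ P x e = H k (y k) ^ (p - 1) * fderiv ℝ (H k) (y k) e := by
  have hline : ∀ {h : E → ℝ} {z d : E}, DifferentiableAt ℝ h z → 0 < h z →
      HasDerivAt (fun s : ℝ => h (z + s • d) ^ p) (p * h z ^ (p - 1) * fderiv ℝ h z d) 0 := by
    intro h z d hh hpos
    have hz : z + (0 : ℝ) • d = z := by simp
    simpa only [hz] using hasDerivAt_rpow_comp_line (x := z) (e := d) (r := 0) p (by rwa [hz])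
      (by rwa [hz])
  have h0 := (hmin (Pi.single k 1) e).hasDerivAt_eq_zero ((hline hP hPpos).sub
    (HasDerivAt.fun_sum fun i _ => (hline (hH i) (hHpos i)).const_mul (w i)))
  have hs : ∑ i, w i * (Pi.single k 1 : Fin m → ℝ) i = w k := by
    rw [Finset.sum_eq_single k] <;> simp +contextual
  rw [hs, Finset.sum_eq_single k (by
    intro i _ hik
    simp [Pi.single_eq_of_ne hik]) (by simp)] at h0
  simp only [Pi.single_eq_same, one_smul, map_smul, smul_eq_mul] at h0
  have hpw : p * w k ≠ 0 := (mul_pos hp (hw k)).ne'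
  refine mul_left_cancel₀ hpw ?_
  linarith

/-- Moving the `i`-th point with speed proportional to `Hᵢ ^ p` makes the gradient terms in the
second order condition cancel. -/
theorem sum_mul_hessian_le_of_isLocalMin (hp : 0 < p) (hw : ∀ i, 0 < w i)
    (hP : ContDiffAt ℝ 2 P x) (hPpos : 0 < P x)
    (hH : ∀ i, ContDiffAt ℝ 2 (H i) (y i)) (hHpos : ∀ i, 0 < H i (y i))
    (hval : P x ^ p = ∑ i, w i * H i (y i) ^ p)
    (hmin : ∀ (c : Fin m → ℝ) (e : E), IsLocalMin (fun r : ℝ =>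
      P (x + r • ((∑ i, w i * c i) • e)) ^ p - ∑ i, w i * H i (y i + r • (c i • e)) ^ p) 0)
    (e : E) :
    ∑ i, w i * ((H i (y i) ^ p / P x ^ p) ^ 2 *
      (H i (y i) ^ (p - 1) * iteratedFDeriv ℝ 2 (H i) (y i) ![e, e])) ≤
      P x ^ (p - 1) * iteratedFDeriv ℝ 2 P x ![e, e] := by
  have hV : 0 < P x ^ p := Real.rpow_pos_of_pos hPpos p
  let c : Fin m → ℝ := fun i => H i (y i) ^ p / P x ^ p
  have hc : ∑ i, w i * c i = 1 := by
    simp only [c, ← mul_div_assoc]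
    rw [← Finset.sum_div, ← hval, div_self hV.ne']
  have hmin' := hmin c e
  rw [hc] at hmin'
  have hc1 := contDiffAt_rpow_comp_line ((1 : ℝ) • e) p hP hPpos
  have hc2 : ∀ i, ContDiffAt ℝ 2 (fun s : ℝ => H i (y i + s • (c i • e)) ^ p) 0 := fun i =>
    contDiffAt_rpow_comp_line (c i • e) p (hH i) (hHpos i)
  have hc3 : ContDiffAt ℝ 2 (fun s : ℝ => ∑ i, w i * H i (y i + s • (c i • e)) ^ p) 0 :=
    ContDiffAt.sum fun i _ => contDiffAt_const.mul (hc2 i)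
  have h0 := deriv_deriv_nonneg_of_isLocalMin hmin' (hc1.sub hc3).continuousAt
  have htwo : ∀ g : ℝ → ℝ, iteratedDeriv 2 g = deriv (deriv g) := fun g => by
    rw [iteratedDeriv_succ, iteratedDeriv_one]
  rw [← htwo, iteratedDeriv_fun_sub hc1 hc3,
    iteratedDeriv_fun_sum fun i _ => contDiffAt_const.mul (hc2 i)] at h0
  simp only [iteratedDeriv_const_mul_field] at h0
  simp only [htwo] at h0
  rw [deriv_deriv_rpow_comp_line _ p hP hPpos] at h0
  simp only [fun i => deriv_deriv_rpow_comp_line (c i • e) p (hH i) (hHpos i)] at h0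
  simp only [iteratedFDeriv_two_apply, Matrix.cons_val_zero, Matrix.cons_val_one, map_smul,
    smul_apply, smul_eq_mul, one_smul] at h0 ⊢
  -- all the points share the weighted gradient `q`
  set q := P x ^ (p - 1) * fderiv ℝ P x e with hq
  have hgrad : ∀ k, H k (y k) ^ (p - 1) * fderiv ℝ (H k) (y k) e = q := fun k =>
    (rpow_mul_fderiv_eq_of_isLocalMin hp hw (hP.differentiableAt (by simp)) hPpos
      (fun i => (hH i).differentiableAt (by simp)) hHpos hmin k e).symm
  have hpow : ∀ {a d : ℝ}, 0 < a → a ^ (p - 1) * d = q → a ^ (p - 2) * d ^ 2 = q ^ 2 / a ^ p := by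
    intro a d ha had
    have h1 : a ^ (p - 2) = (a ^ (p - 1)) ^ 2 / a ^ p := by
      rw [← Real.rpow_natCast, ← Real.rpow_mul ha.le, ← Real.rpow_sub ha]
      congr 1
      push_cast
      ring
    rw [h1, ← had]
    ring
  have hgradsum : ∑ i, w i * (p * ((p - 1) * (H i (y i) ^ (p - 2) *
      (c i * fderiv ℝ (H i) (y i) e) ^ 2))) =
      p * ((p - 1) * (P x ^ (p - 2) * fderiv ℝ P x e ^ 2)) := by
    rw [hpow hPpos rfl]
    have hterm : ∀ i, w i * (p * ((p - 1) * (H i (y i) ^ (p - 2) *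
        (c i * fderiv ℝ (H i) (y i) e) ^ 2))) =
        p * ((p - 1) * (q ^ 2 / P x ^ p)) * (w i * c i) := by
      intro i
      have hA : 0 < H i (y i) ^ p := Real.rpow_pos_of_pos (hHpos i) p
      rw [mul_pow, mul_left_comm (H i (y i) ^ (p - 2)), hpow (hHpos i) (hgrad i)]
      simp only [c]
      field_simp
    simp only [hterm]
    rw [← Finset.mul_sum, hc, mul_one]
  simp only [mul_add, Finset.sum_add_distrib] at h0
  rw [hgradsum] at h0
  have hmain : ∑ i, w i * (p * (H i (y i) ^ (p - 1) *
      (c i * (c i * fderiv ℝ (fderiv ℝ (H i)) (y i) e e)))) =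
      p * ∑ i, w i * ((H i (y i) ^ p / P x ^ p) ^ 2 *
        (H i (y i) ^ (p - 1) * fderiv ℝ (fderiv ℝ (H i)) (y i) e e)) := by
    rw [Finset.mul_sum]
    refine Finset.sum_congr rfl fun i _ => ?_
    simp only [c]
    ring
  rw [hmain] at h0
  refine le_of_mul_le_mul_left ?_ hp
  linarith

end Space

/-! ### The first order condition in time -/

theorem hasDerivAt_rpow_comp_time {g : ℝ → ℝ} {t α p : ℝ} (b : ℝ) (hα : 0 < α) (ht : 0 < t)
    (hg : DifferentiableAt ℝ g t) (hpos : 0 < g t) :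
    HasDerivAt (fun r : ℝ => g ((t ^ α + r * b) ^ (1 / α)) ^ p)
      (p / α * b * (g t ^ (p - 1) * deriv g t * (t ^ α) ^ (1 / α - 1))) 0 := by
  have ht' : (t ^ α + 0 * b) ^ (1 / α) = t := by
    rw [zero_mul, add_zero, ← Real.rpow_mul ht.le, mul_one_div_cancel hα.ne', Real.rpow_one]
  have h1 : HasDerivAt (fun r : ℝ => t ^ α + r * b) b 0 := by
    simpa using ((hasDerivAt_id (0 : ℝ)).mul_const b).const_add (t ^ α)
  have h2 := h1.rpow_const (p := 1 / α) (Or.inl (by simpa using (Real.rpow_pos_of_pos ht α).ne'))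
  have hg' : HasDerivAt g (deriv g t) ((t ^ α + 0 * b) ^ (1 / α)) := by
    rw [ht']
    exact hg.hasDerivAt
  have h3 := (hg'.comp (0 : ℝ) h2).rpow_const (p := p)
    (Or.inl (by simp only [Function.comp, ht']; exact hpos.ne'))
  simp only [Function.comp_def, ht'] at h3
  convert h3 using 1
  simp only [zero_mul, add_zero]
  ring

theorem rpow_mul_deriv_eq_of_isLocalMin {m : ℕ} {p α t : ℝ} {w τ : Fin m → ℝ} {g : ℝ → ℝ}
    {G : Fin m → ℝ → ℝ} (hp : 0 < p) (hα : 0 < α) (hw : ∀ i, 0 < w i) (ht : 0 < t)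
    (hτ : ∀ i, 0 < τ i) (hg : DifferentiableAt ℝ g t) (hgpos : 0 < g t)
    (hG : ∀ i, DifferentiableAt ℝ (G i) (τ i)) (hGpos : ∀ i, 0 < G i (τ i))
    (hmin : ∀ b : Fin m → ℝ, IsLocalMin (fun r : ℝ =>
      g ((t ^ α + r * ∑ i, w i * b i) ^ (1 / α)) ^ p -
        ∑ i, w i * G i ((τ i ^ α + r * b i) ^ (1 / α)) ^ p) 0) (k : Fin m) :
    g t ^ (p - 1) * deriv g t * (t ^ α) ^ (1 / α - 1) =
      G k (τ k) ^ (p - 1) * deriv (G k) (τ k) * (τ k ^ α) ^ (1 / α - 1) := by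
  have h0 := (hmin (Pi.single k 1)).hasDerivAt_eq_zero
    ((hasDerivAt_rpow_comp_time _ hα ht hg hgpos).sub
      (HasDerivAt.fun_sum fun i _ =>
        (hasDerivAt_rpow_comp_time _ hα (hτ i) (hG i) (hGpos i)).const_mul (w i)))
  have hs : ∑ i, w i * (Pi.single k 1 : Fin m → ℝ) i = w k := by
    rw [Finset.sum_eq_single k] <;> simp +contextual
  rw [hs, Finset.sum_eq_single k (by
    intro i _ hik
    simp [Pi.single_eq_of_ne hik]) (by simp), Pi.single_eq_same] at h0
  have hpw : p / α * w k ≠ 0 := (mul_pos (div_pos hp hα) (hw k)).ne'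
  refine mul_left_cancel₀ hpw ?_
  linarith

/-! ### Convexity of the coefficients -/

/-- Joint convexity of `(A, s) ↦ A ^ 2 / s ^ β` for `0 ≤ β ≤ 1`. -/
theorem sq_sum_div_rpow_le {m : ℕ} {β : ℝ} (hβ0 : 0 ≤ β) (hβ1 : β ≤ 1) {w A s : Fin m → ℝ}
    (hw : ∀ i, 0 < w i) (hw1 : ∑ i, w i = 1) (hs : ∀ i, 0 < s i) :
    (∑ i, w i * A i) ^ 2 / (∑ i, w i * s i) ^ β ≤ ∑ i, w i * (A i ^ 2 / s i ^ β) := by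
  have hne : (Finset.univ : Finset (Fin m)).Nonempty := by
    by_contra h
    rw [Finset.not_nonempty_iff_eq_empty] at h
    simp [h] at hw1
  have hsβ : ∀ i, 0 < w i * s i ^ β := fun i => mul_pos (hw i) (Real.rpow_pos_of_pos (hs i) β)
  have hconc : ∑ i, w i * s i ^ β ≤ (∑ i, w i * s i) ^ β := by
    simpa only [smul_eq_mul] using (Real.concaveOn_rpow hβ0 hβ1).le_map_sum
      (t := Finset.univ) (w := w) (p := s) (fun i _ => (hw i).le) hw1 fun i _ => (hs i).le
  calc (∑ i, w i * A i) ^ 2 / (∑ i, w i * s i) ^ β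
      ≤ (∑ i, w i * A i) ^ 2 / ∑ i, w i * s i ^ β :=
        div_le_div_of_nonneg_left (sq_nonneg _) (Finset.sum_pos (fun i _ => hsβ i) hne) hconc
    _ ≤ ∑ i, (w i * A i) ^ 2 / (w i * s i ^ β) :=
        Finset.sq_sum_div_le_sum_sq_div _ _ fun i _ => hsβ i
    _ = ∑ i, w i * (A i ^ 2 / s i ^ β) := by
        refine Finset.sum_congr rfl fun i _ => ?_
        have := (hw i).ne'
        have := (Real.rpow_pos_of_pos (hs i) β).ne'
        field_simp

/-- The arithmetic of the conclusion: `A`, `V` stand for `u ^ p`, `B`, `U` for `u ^ (p - 1)`,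
`T`, `T₀` for time derivatives, `F`, `F₀` for the values of the nonlinearity and `X` for the
Laplacian of the test function. -/
theorem le_add_of_sum_le {m : ℕ} {β : ℝ} (hβ0 : 0 ≤ β) (hβ1 : β ≤ 1)
    {w A B s T F : Fin m → ℝ} {V U S T₀ F₀ X κ : ℝ}
    (hw : ∀ i, 0 < w i) (hw1 : ∑ i, w i = 1) (hs : ∀ i, 0 < s i)
    (hV : 0 < V) (hU : 0 < U) (hκ : 0 ≤ κ)
    (hVA : V = ∑ i, w i * A i) (hSs : S = ∑ i, w i * s i)
    (hT : ∀ i, B i * T i * s i ^ β = κ) (hT₀ : U * T₀ * S ^ β = κ) (hS : 0 < S)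
    (hX : ∑ i, w i * ((A i / V) ^ 2 * (B i * (T i - F i))) ≤ U * X)
    (hF : ∑ i, w i * (A i ^ 2 * B i * F i) ≤ V ^ 2 * U * F₀) :
    T₀ ≤ X + F₀ := by
  have h1 : ∑ i, w i * (A i ^ 2 * B i * T i) = κ * ∑ i, w i * (A i ^ 2 / s i ^ β) := by
    rw [Finset.mul_sum]
    refine Finset.sum_congr rfl fun i _ => ?_
    have := (Real.rpow_pos_of_pos (hs i) β).ne'
    rw [← hT i]
    field_simp
  have h2 : V ^ 2 * U * T₀ ≤ ∑ i, w i * (A i ^ 2 * B i * T i) := by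
    rw [h1]
    refine le_trans (le_of_eq ?_)
      (mul_le_mul_of_nonneg_left (sq_sum_div_rpow_le (A := A) hβ0 hβ1 hw hw1 hs) hκ)
    rw [← hVA, ← hSs, ← hT₀]
    have := (Real.rpow_pos_of_pos hS β).ne'
    field_simp
  have h3 : ∑ i, w i * ((A i / V) ^ 2 * (B i * (T i - F i))) =
      (∑ i, w i * (A i ^ 2 * B i * T i) - ∑ i, w i * (A i ^ 2 * B i * F i)) / V ^ 2 := by
    rw [← Finset.sum_sub_distrib, Finset.sum_div]
    refine Finset.sum_congr rfl fun i _ => ?_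
    field_simp
  rw [h3, div_le_iff₀ (by positivity)] at hX
  have hVU : 0 < V ^ 2 * U := by positivity
  refine le_of_mul_le_mul_left ?_ hVU
  linarith

/-! ### Envelopes are viscosity subsolutions -/

section Subsolution

variable {n : ℕ} {Ω : Set (EuclideanSpace ℝ (Fin n))}
  {f : EuclideanSpace ℝ (Fin n) → ℝ → ℝ → EuclideanSpace ℝ (Fin n) → ℝ}
  {u : EuclideanSpace ℝ (Fin n) × ℝ → ℝ} {p α : ℝ}

/-- A function `φ` touching the envelope from above at `combine α w ζ` dominates the power means of
`u` over all competitors near `ζ`. -/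
theorem eventually_sum_rpow_le (hΩo : IsOpen Ω) (hΩb : Bornology.IsBounded Ω) (hp : 0 < p)
    (hα : 0 < α) (huc : ContinuousOn u (closure (cyl Ω))) (hnn : ∀ z ∈ closure (cyl Ω), 0 ≤ u z)
    {w : Fin (n + 1) → ℝ} (hw : w ∈ Weights (n + 1)) {φ : EuclideanSpace ℝ (Fin n) × ℝ → ℝ}
    {ζ : Fin (n + 1) → EuclideanSpace ℝ (Fin n) × ℝ} (hζ : ∀ i, ζ i ∈ cyl Ω)
    (hφ : ∀ᶠ z in 𝓝 (combine α w ζ), lambdaEnvelope Ω α p w u z ≤ φ z) :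
    ∀ᶠ ζ' in 𝓝 ζ, ∑ i, w i * u (ζ' i) ^ p ≤ φ (combine α w ζ') ^ p := by
  have hD : ∀ᶠ ζ' in 𝓝 ζ, ∀ i, ζ' i ∈ cyl Ω := eventually_all.2 fun i =>
    (continuous_apply i).continuousAt.eventually_mem ((isOpen_cyl hΩo).mem_nhds (hζ i))
  filter_upwards [hD, (continuous_combine hα w).continuousAt.eventually hφ] with ζ' h₁ h₂
  have h₃ : ∀ i, ζ' i ∈ closure (cyl Ω) := fun i => subset_closure (h₁ i)
  rw [← powerMean_rpow hp (fun i => hnn _ (h₃ i)) (Weights.nonneg hw)]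
  exact Real.rpow_le_rpow (powerMean_nonneg p (fun i => hnn _ (h₃ i)) (Weights.nonneg hw))
    ((powerMean_le_lambdaEnvelope
      (isCompact_envelopeValues hΩb hα hp hw huc _).bddAbove h₃ rfl).trans h₂) hp.le

theorem rpow_mul_rpow_eq {a : ℝ} (ha : 0 < a) (p : ℝ) (hp : 0 < p) :
    (a ^ p) ^ (3 - 1 / p) = (a ^ p) ^ 2 * a ^ (p - 1) := by
  rw [← Real.rpow_natCast, ← Real.rpow_mul ha.le, ← Real.rpow_mul ha.le, ← Real.rpow_add ha]
  congr 1
  field_simp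
  push_cast
  ring

/-- Jensen's inequality for the nonlinearity at points whose weighted gradients
`vᵢ ^ (p - 1) θᵢ` agree. -/
theorem sum_nonlinearity_le {m : ℕ} (hp : 0 < p) (hα : 0 < α)
    (h_conc : ∀ θ : EuclideanSpace ℝ (Fin n),
      ConcaveOn ℝ (cyl Ω ×ˢ Ioi (0 : ℝ))
        (fun q : (EuclideanSpace ℝ (Fin n) × ℝ) × ℝ =>
          q.2 ^ (3 - 1 / p) *
            f q.1.1 (q.1.2 ^ (1 / α)) (q.2 ^ (1 / p)) (q.2 ^ (1 / p - 1) • θ)))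
    {w : Fin m → ℝ} (hw : w ∈ Weights m) {ζ : Fin m → EuclideanSpace ℝ (Fin n) × ℝ}
    (hζ : ∀ i, ζ i ∈ cyl Ω) {a : Fin m → ℝ} (ha : ∀ i, 0 < a i)
    {b : Fin m → EuclideanSpace ℝ (Fin n)} {z₀ : EuclideanSpace ℝ (Fin n) × ℝ} {a₀ : ℝ}
    {b₀ : EuclideanSpace ℝ (Fin n)} (hz₀ : 0 < z₀.2) (ha₀ : 0 < a₀)
    (hz : z₀.1 = ∑ i, w i • (ζ i).1) (ht : z₀.2 ^ α = ∑ i, w i * (ζ i).2 ^ α)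
    (haa : a₀ ^ p = ∑ i, w i * a i ^ p)
    (hb : ∀ i, a i ^ (p - 1) • b i = a₀ ^ (p - 1) • b₀) :
    ∑ i, w i * ((a i ^ p) ^ 2 * a i ^ (p - 1) * f (ζ i).1 (ζ i).2 (a i) (b i)) ≤
      (a₀ ^ p) ^ 2 * a₀ ^ (p - 1) * f z₀.1 z₀.2 a₀ b₀ := by
  set θ := a₀ ^ (p - 1) • b₀ with hθ
  have hval : ∀ {z : EuclideanSpace ℝ (Fin n) × ℝ} {c : ℝ} {d : EuclideanSpace ℝ (Fin n)},
      0 < z.2 → 0 < c → c ^ (p - 1) • d = θ →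
      (c ^ p) ^ (3 - 1 / p) * f z.1 ((z.2 ^ α) ^ (1 / α)) ((c ^ p) ^ (1 / p))
        ((c ^ p) ^ (1 / p - 1) • θ) = (c ^ p) ^ 2 * c ^ (p - 1) * f z.1 z.2 c d := by
    intro z c d hzt hc hd
    have h1 : (c ^ p) ^ (1 / p - 1) • θ = d := by
      rw [← hd, smul_smul, ← Real.rpow_mul hc.le, ← Real.rpow_add hc]
      have : p * (1 / p - 1) + (p - 1) = 0 := by
        field_simp
        ring
      rw [this, Real.rpow_zero, one_smul]
    rw [h1, rpow_mul_rpow_eq hc p hp, ← Real.rpow_mul hzt.le, mul_one_div_cancel hα.ne',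
      ← Real.rpow_mul hc.le, mul_one_div_cancel hp.ne', Real.rpow_one, Real.rpow_one]
  have hJ := (h_conc θ).le_map_sum (t := Finset.univ) (w := w)
    (p := fun i => (((ζ i).1, (ζ i).2 ^ α), a i ^ p)) (fun i _ => Weights.nonneg hw i) hw.2
    fun i _ => ⟨⟨(hζ i).1, Real.rpow_pos_of_pos (hζ i).2 α⟩, Real.rpow_pos_of_pos (ha i) p⟩
  have hsum : ∑ i, w i • ((((ζ i).1, (ζ i).2 ^ α), a i ^ p) : (EuclideanSpace ℝ (Fin n) × ℝ) × ℝ) =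
      ((z₀.1, z₀.2 ^ α), a₀ ^ p) := by
    ext1
    · ext1
      · simp [Prod.fst_sum, hz]
      · simp [Prod.fst_sum, Prod.snd_sum, ht]
    · simp [Prod.snd_sum, haa]
  rw [hsum] at hJ
  simp only [hval hz₀ ha₀ rfl] at hJ
  refine le_trans (le_of_eq (Finset.sum_congr rfl fun i _ => ?_)) hJ
  rw [smul_eq_mul, hval (hζ i).2 (ha i) (hb i)]

/-- The inequality defining viscosity subsolutions, for a test function touching the envelope from
above at `z₀`. -/
theorem dt_le_of_touches_lambdaEnvelope (hΩo : IsOpen Ω) (hΩ : Convex ℝ Ω)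
    (hΩb : Bornology.IsBounded Ω) (hp : 0 < p) (hα0 : 1 / 2 ≤ α) (hα1 : α ≤ 1)
    (hu : IsClassicalSolution Ω f u)
    (hu0 : ∀ z ∈ frontier (cyl Ω), u z = 0) (hmono : ∀ z ∈ cyl Ω, 0 ≤ dt u z)
    (hgrowth : ∀ x ∈ closure Ω, ∀ y ∈ Ω,
      Tendsto (fun ρ : ℝ => u (x + ρ • direction x y, ρ ^ (1 / α)) ^ p / ρ) (𝓝[>] 0) atTop)
    (h_conc : ∀ θ : EuclideanSpace ℝ (Fin n),
      ConcaveOn ℝ (cyl Ω ×ˢ Ioi (0 : ℝ))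
        (fun q : (EuclideanSpace ℝ (Fin n) × ℝ) × ℝ =>
          q.2 ^ (3 - 1 / p) *
            f q.1.1 (q.1.2 ^ (1 / α)) (q.2 ^ (1 / p)) (q.2 ^ (1 / p - 1) • θ)))
    {w : Fin (n + 1) → ℝ} (hw : w ∈ Weights (n + 1))
    {z₀ : EuclideanSpace ℝ (Fin n) × ℝ} (hz₀ : z₀ ∈ cyl Ω)
    {φ : EuclideanSpace ℝ (Fin n) × ℝ → ℝ} (hφ : C21On (cyl Ω) φ)
    (hφ₀ : φ z₀ = lambdaEnvelope Ω α p w u z₀)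
    (hφge : ∀ᶠ z in 𝓝 z₀, lambdaEnvelope Ω α p w u z ≤ φ z) :
    dt φ z₀ ≤ lapX φ z₀ + f z₀.1 z₀.2 (φ z₀) (gradX φ z₀) := by
  have hα : 0 < α := by linarith
  have huc := hu.continuousOn_closure
  have hnn : ∀ z ∈ closure (cyl Ω), 0 ≤ u z := fun z hz =>
    nonneg_of_mem_closure_cyl hΩo hu hu0 hmono hz
  have hpos : ∀ {z}, z ∈ cyl Ω → 0 < u z := fun hz =>
    pos_of_mem_cyl hΩo hp hα hu hu0 hmono hgrowth hz
  obtain ⟨ζ, hζ, hζz, hmax⟩ := exists_eq_lambdaEnvelope hΩb hα hp hw huc (subset_closure hz₀)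
  have hζD := mem_cyl_of_eq_lambdaEnvelope hΩo hΩ hΩb hp hα hu hu0 hmono hgrowth hw hz₀ hζ hζz hmax
  have hζ2 : ∀ i, 0 < (ζ i).2 := fun i => (hζD i).2
  have hz2 : (0 : ℝ) < z₀.2 := hz₀.2
  have hwpos : ∀ i, 0 < w i := Weights.pos hw
  have hφpos : 0 < φ z₀ := by
    rw [hφ₀]
    exact (hpos hz₀).trans_le (le_lambdaEnvelope hΩb hα hp hw huc (subset_closure hz₀)
      (hpos hz₀).le)
  have hz1 : z₀.1 = ∑ i, w i • (ζ i).1 := by rw [← hζz]; rfl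
  have ht : z₀.2 ^ α = ∑ i, w i * (ζ i).2 ^ α := by
    rw [← hζz]
    exact powerMean_rpow hα (fun i => (hζ2 i).le) (Weights.nonneg hw)
  have hval : φ z₀ ^ p = ∑ i, w i * u (ζ i) ^ p := by
    rw [hφ₀, ← hmax, powerMean_rpow hp (fun i => (hpos (hζD i)).le) (Weights.nonneg hw)]
  have hloc := eventually_sum_rpow_le hΩo hΩb hp hα huc hnn hw hζD (by rwa [hζz])
  -- the competitors move in space only, then in time only; with the other variable frozen, `φ` and
  -- `u` are regular enough for the one-variable calculus above
  have hspace : ∀ (c : Fin (n + 1) → ℝ) (e : EuclideanSpace ℝ (Fin n)), IsLocalMin (fun r : ℝ =>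
      φ (z₀.1 + r • ((∑ i, w i * c i) • e), z₀.2) ^ p -
        ∑ i, w i * u ((ζ i).1 + r • (c i • e), (ζ i).2) ^ p) 0 := by
    intro c e
    have hcurve : Tendsto (fun (r : ℝ) i => (((ζ i).1 + r • (c i • e), (ζ i).2) :
        EuclideanSpace ℝ (Fin n) × ℝ)) (𝓝 0) (𝓝 ζ) := by
      have : ContinuousAt (fun (r : ℝ) i => (((ζ i).1 + r • (c i • e), (ζ i).2) :
        EuclideanSpace ℝ (Fin n) × ℝ)) 0 := by fun_prop
      simpa [ContinuousAt] using this
    filter_upwards [hcurve.eventually hloc] with r hr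
    have hcomb : combine α w (fun i => ((ζ i).1 + r • (c i • e), (ζ i).2)) =
        (z₀.1 + r • ((∑ i, w i * c i) • e), z₀.2) := by
      rw [← hζz]
      ext1
      · simp only [combine, smul_add, Finset.sum_add_distrib, Finset.sum_smul, Finset.smul_sum,
          smul_smul]
        congr 1
        refine Finset.sum_congr rfl fun i _ => ?_
        congr 1
        ring
      · rfl
    rw [hcomb] at hr
    simp only [zero_smul, add_zero]
    linarith
  have htime : ∀ b : Fin (n + 1) → ℝ, IsLocalMin (fun r : ℝ =>
      φ (z₀.1, (z₀.2 ^ α + r * ∑ i, w i * b i) ^ (1 / α)) ^ p -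
        ∑ i, w i * u ((ζ i).1, ((ζ i).2 ^ α + r * b i) ^ (1 / α)) ^ p) 0 := by
    intro b
    have hpowζ : ∀ {t : ℝ}, 0 < t → (t ^ α) ^ (1 / α) = t := fun ht => by
      rw [← Real.rpow_mul ht.le, mul_one_div_cancel hα.ne', Real.rpow_one]
    have hcurve : Tendsto (fun r : ℝ => shift α ζ (fun _ => 0) (fun i => r * b i)) (𝓝 0) (𝓝 ζ) := by
      have : ContinuousAt (fun r : ℝ => shift α ζ (fun _ => 0) (fun i => r * b i)) 0 := by
        refine continuousAt_pi.2 fun i => ContinuousAt.prodMk (by fun_prop) ?_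
        exact ContinuousAt.rpow_const (by fun_prop) (Or.inr (by positivity))
      have h0 : shift α ζ (fun _ => 0) (fun i => (0 : ℝ) * b i) = ζ := by
        ext1 i
        exact shift_of_eq_zero hα (hζ2 i).le rfl (zero_mul _)
      rwa [ContinuousAt, h0] at this
    have hδ : ∀ᶠ r in 𝓝 (0 : ℝ), ∀ i, 0 ≤ (ζ i).2 ^ α + r * b i := eventually_all.2 fun i => by
      have : ContinuousAt (fun r : ℝ => (ζ i).2 ^ α + r * b i) 0 := by fun_prop
      filter_upwards [this.eventually_const_lt (u := 0)
        (by simpa using Real.rpow_pos_of_pos (hζ2 i) α)] with r hr using hr.le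
    filter_upwards [hcurve.eventually hloc, hδ] with r hr hrδ
    rw [combine_shift hα (fun i => (hζ2 i).le) (Weights.nonneg hw) hrδ, hζz] at hr
    have hsum : ∑ i, w i * (r * b i) = r * ∑ i, w i * b i := by
      rw [Finset.mul_sum]
      exact Finset.sum_congr rfl fun i _ => by ring
    simp only [shift, smul_zero, Finset.sum_const_zero, add_zero, hsum] at hr
    simp only [zero_mul, add_zero, hpowζ hz2, fun i => hpowζ (hζ2 i)]
    linarith
  have hPspace := hφ.contDiffAt_space z₀ hz₀
  have hHspace := fun i => hu.c21.contDiffAt_space (ζ i) (hζD i)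
  have hHpos := fun i => hpos (hζD i)
  have hgrad : ∀ i, u (ζ i) ^ (p - 1) • gradX u (ζ i) = φ z₀ ^ (p - 1) • gradX φ z₀ := by
    intro i
    refine ext_inner_right ℝ fun e => ?_
    have := rpow_mul_fderiv_eq_of_isLocalMin (P := fun x => φ (x, z₀.2))
      (H := fun i x => u (x, (ζ i).2)) (x := z₀.1) (y := fun i => (ζ i).1) hp hwpos
      (hPspace.differentiableAt (by simp)) hφpos
      (fun i => (hHspace i).differentiableAt (by simp)) hHpos hspace i e
    simp only [gradX, gradient, inner_smul_left, InnerProductSpace.toDual_symm_apply]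
    exact this.symm
  have htimeEq := fun i => rpow_mul_deriv_eq_of_isLocalMin (g := fun t => φ (z₀.1, t))
    (G := fun i t => u ((ζ i).1, t)) (t := z₀.2) (τ := fun i => (ζ i).2) hp hα hwpos hz2 hζ2
    (hφ.differentiableAt_time z₀ hz₀) hφpos (fun i => hu.c21.differentiableAt_time (ζ i) (hζD i))
    hHpos htime i
  have hlap : ∑ i, w i * ((u (ζ i) ^ p / φ z₀ ^ p) ^ 2 *
      (u (ζ i) ^ (p - 1) * lapX u (ζ i))) ≤ φ z₀ ^ (p - 1) * lapX φ z₀ := by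
    simp only [lapX, laplacian_eq_sum_stdBasis, Finset.mul_sum]
    rw [Finset.sum_comm]
    refine Finset.sum_le_sum fun k _ => ?_
    exact sum_mul_hessian_le_of_isLocalMin (P := fun x => φ (x, z₀.2))
      (H := fun i x => u (x, (ζ i).2)) (x := z₀.1) (y := fun i => (ζ i).1) hp hwpos
      hPspace hφpos hHspace hHpos hval hspace _
  refine le_add_of_sum_le (β := 1 / α - 1) (w := w) (A := fun i => u (ζ i) ^ p)
    (B := fun i => u (ζ i) ^ (p - 1)) (s := fun i => (ζ i).2 ^ α) (T := fun i => dt u (ζ i))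
    (F := fun i => f (ζ i).1 (ζ i).2 (u (ζ i)) (gradX u (ζ i)))
    (V := φ z₀ ^ p) (U := φ z₀ ^ (p - 1)) (S := z₀.2 ^ α)
    (κ := φ z₀ ^ (p - 1) * dt φ z₀ * (z₀.2 ^ α) ^ (1 / α - 1)) ?_ ?_ hwpos hw.2
    (fun i => Real.rpow_pos_of_pos (hζ2 i) α) (Real.rpow_pos_of_pos hφpos p)
    (Real.rpow_pos_of_pos hφpos _) ?_ hval ht (fun i => (htimeEq i).symm) rfl
    (Real.rpow_pos_of_pos hz2 α) ?_ ?_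
  · rw [sub_nonneg, le_div_iff₀ hα]
    linarith
  · rw [sub_le_iff_le_add, div_le_iff₀ hα]
    linarith
  · have h0 := htimeEq 0
    change φ z₀ ^ (p - 1) * dt φ z₀ * _ = u (ζ 0) ^ (p - 1) * dt u (ζ 0) * _ at h0
    rw [h0]
    exact mul_nonneg (mul_nonneg (Real.rpow_nonneg (hHpos 0).le _) (hmono _ (hζD 0)))
      (Real.rpow_nonneg (Real.rpow_nonneg (hζ2 0).le _) _)
  · have : ∀ i, dt u (ζ i) - f (ζ i).1 (ζ i).2 (u (ζ i)) (gradX u (ζ i)) = lapX u (ζ i) :=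
      fun i => sub_eq_of_eq_add (hu.eqn _ (hζD i))
    simpa only [this] using hlap
  · exact sum_nonlinearity_le hp hα h_conc hw hζD hHpos hz2 hφpos hz1 ht hval hgrad

theorem isViscositySubsolution_lambdaEnvelope (hΩo : IsOpen Ω) (hΩ : Convex ℝ Ω)
    (hΩb : Bornology.IsBounded Ω) (hp : 0 < p) (hα0 : 1 / 2 ≤ α) (hα1 : α ≤ 1)
    (hu : IsClassicalSolution Ω f u)
    (hu0 : ∀ z ∈ frontier (cyl Ω), u z = 0) (hmono : ∀ z ∈ cyl Ω, 0 ≤ dt u z)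
    (hgrowth : ∀ x ∈ closure Ω, ∀ y ∈ Ω,
      Tendsto (fun ρ : ℝ => u (x + ρ • direction x y, ρ ^ (1 / α)) ^ p / ρ) (𝓝[>] 0) atTop)
    (h_conc : ∀ θ : EuclideanSpace ℝ (Fin n),
      ConcaveOn ℝ (cyl Ω ×ˢ Ioi (0 : ℝ))
        (fun q : (EuclideanSpace ℝ (Fin n) × ℝ) × ℝ =>
          q.2 ^ (3 - 1 / p) *
            f q.1.1 (q.1.2 ^ (1 / α)) (q.2 ^ (1 / p)) (q.2 ^ (1 / p - 1) • θ)))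
    {w : Fin (n + 1) → ℝ} (hw : w ∈ Weights (n + 1)) :
    IsViscositySubsolution Ω f (lambdaEnvelope Ω α p w u) where
  usc := (upperSemicontinuousOn_lambdaEnvelope hΩb (by linarith) hp hw
    hu.continuousOn_closure).mono subset_closure
  test _ hz₀ _ hφ hφ₀ hφge := dt_le_of_touches_lambdaEnvelope hΩo hΩ hΩb hp hα0 hα1 hu hu0 hmono
    hgrowth h_conc hw hz₀ hφ hφ₀ hφge

end Subsolution

/-! ### Parabolic concavity -/

/-- The weights `(1 - l, l / n, …, l / n)`. -/
theorem cons_mem_weights {n : ℕ} (hn : 1 ≤ n) {l : ℝ} (hl : l ∈ Ioo (0 : ℝ) 1) :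
    (Fin.cons (1 - l) fun _ => l / n : Fin (n + 1) → ℝ) ∈ Weights (n + 1) := by
  have hn1 : (1 : ℝ) ≤ n := by exact_mod_cast hn
  have hn0 : (0 : ℝ) < n := by linarith
  refine ⟨fun i => ?_, ?_⟩
  · refine Fin.cases ?_ (fun i => ?_) i
    · exact ⟨by simpa using hl.2, by simpa using hl.1⟩
    · refine ⟨by simpa using div_pos hl.1 hn0, ?_⟩
      simp only [Fin.cons_succ]
      rw [div_lt_one hn0]
      exact hl.2.trans_le hn1
  · rw [Fin.sum_univ_succ]
    simp only [Fin.cons_zero, Fin.cons_succ, Finset.sum_const, Finset.card_univ, Fintype.card_fin,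
      nsmul_eq_mul]
    rw [mul_div_cancel₀ _ hn0.ne']
    ring

theorem powerMean_cons {n : ℕ} (hn : 1 ≤ n) (q a b l : ℝ) :
    powerMean q (Fin.cons a fun _ => b : Fin (n + 1) → ℝ) (Fin.cons (1 - l) fun _ => l / n) =
      powerMeanTwo q a b l := by
  have hn0 : (n : ℝ) ≠ 0 := by
    have : n ≠ 0 := by omega
    exact_mod_cast this
  rw [powerMean, powerMeanTwo, Fin.sum_univ_succ]
  simp only [Fin.cons_zero, Fin.cons_succ, Finset.sum_const, Finset.card_univ, Fintype.card_fin,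
    nsmul_eq_mul]
  rw [← mul_assoc, mul_div_cancel₀ _ hn0]

/-- A function which coincides with all its `λ`-envelopes is parabolically concave: two points with
ratio `l` are `n + 1` competitors, the second point being repeated `n` times. -/
theorem isParabolicallyConcaveOn_of_forall_le {n : ℕ} (hn : 1 ≤ n)
    {Ω : Set (EuclideanSpace ℝ (Fin n))} (hΩ : Convex ℝ Ω)
    {u : EuclideanSpace ℝ (Fin n) × ℝ → ℝ} {p α : ℝ} (hnn : ∀ z ∈ closure (cyl Ω), 0 ≤ u z)
    (hbdd : ∀ w ∈ Weights (n + 1), ∀ z ∈ closure (cyl Ω), BddAbove (envelopeValues Ω α p w u z))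
    (hle : ∀ w ∈ Weights (n + 1), ∀ z ∈ closure (cyl Ω), lambdaEnvelope Ω α p w u z ≤ u z) :
    IsParabolicallyConcaveOn α p (closure (cyl Ω)) u := by
  refine ⟨hnn, fun z₁ hz₁ z₂ hz₂ l hl => ?_⟩
  have hw := cons_mem_weights hn hl
  set w : Fin (n + 1) → ℝ := Fin.cons (1 - l) fun _ => l / n with hwdef
  let ζ : Fin (n + 1) → EuclideanSpace ℝ (Fin n) × ℝ := Fin.cons z₁ fun _ => z₂
  have hζ : ∀ i, ζ i ∈ closure (cyl Ω) := fun i => by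
    refine Fin.cases ?_ (fun i => ?_) i
    · exact hz₁
    · exact hz₂
  have hcomp : ∀ g : EuclideanSpace ℝ (Fin n) × ℝ → ℝ,
      (fun i => g (ζ i)) = Fin.cons (g z₁) fun _ => g z₂ := fun g => by
    ext i
    refine Fin.cases ?_ (fun i => ?_) i <;> simp [ζ]
  have hn0 : (n : ℝ) ≠ 0 := by
    have : n ≠ 0 := by omega
    exact_mod_cast this
  have hcomb : combine α w ζ = ((1 - l) • z₁.1 + l • z₂.1, powerMeanTwo α z₁.2 z₂.2 l) := by
    ext1
    · simp only [combine]
      rw [Fin.sum_univ_succ]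
      simp only [w, ζ, Fin.cons_zero, Fin.cons_succ, Finset.sum_const, Finset.card_univ,
        Fintype.card_fin]
      rw [← Nat.cast_smul_eq_nsmul ℝ, smul_smul, mul_div_cancel₀ _ hn0]
    · simp only [combine]
      rw [hcomp Prod.snd, hwdef, powerMean_cons hn]
  have hmem := combine_mem_closure_cyl (α := α) hΩ hw hζ
  have := (powerMean_le_lambdaEnvelope (hbdd w hw _ hmem) hζ rfl).trans (hle w hw _ hmem)
  rwa [hcomp u, hwdef, powerMean_cons hn, ← hwdef, hcomb] at this

end ParabolicPowerConcavity

open ParabolicPowerConcavity in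
theorem theorem3p1 {n : ℕ} (hn : 1 ≤ n)
    (Ω : Set (EuclideanSpace ℝ (Fin n)))
    (hΩ_open : IsOpen Ω) (hΩ_convex : Convex ℝ Ω) (hΩ_bdd : Bornology.IsBounded Ω)
    (hΩ_ne : Ω.Nonempty)
    (f : EuclideanSpace ℝ (Fin n) → ℝ → ℝ → EuclideanSpace ℝ (Fin n) → ℝ)
    (hf_cont : ContinuousOn
      (fun q : (EuclideanSpace ℝ (Fin n) × ℝ) × (ℝ × EuclideanSpace ℝ (Fin n)) =>
        f q.1.1 q.1.2 q.2.1 q.2.2) (cyl Ω ×ˢ univ))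
    (hf_nonneg : ∀ z ∈ cyl Ω, ∀ (v : ℝ) (θ : EuclideanSpace ℝ (Fin n)), 0 ≤ f z.1 z.2 v θ)
    (p α : ℝ) (hp0 : 0 < p) (hp1 : p < 1) (hα0 : 1 / 2 ≤ α) (hα1 : α ≤ 1)
    (u : EuclideanSpace ℝ (Fin n) × ℝ → ℝ)
    (hu : IsClassicalSolution Ω f u)
    (hu_bdry : ∀ z ∈ frontier (cyl Ω), u z = 0)
    (h_mono : ∀ z ∈ cyl Ω, 0 ≤ dt u z)
    (h_growth : ∀ x ∈ closure Ω, ∀ y ∈ Ω,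
      Tendsto (fun ρ : ℝ => u (x + ρ • direction x y, ρ ^ (1 / α)) ^ p / ρ) (𝓝[>] 0) atTop)
    (h_conc : ∀ θ : EuclideanSpace ℝ (Fin n),
      ConcaveOn ℝ (cyl Ω ×ˢ Ioi (0 : ℝ))
        (fun q : (EuclideanSpace ℝ (Fin n) × ℝ) × ℝ =>
          q.2 ^ (3 - 1 / p) *
            f q.1.1 (q.1.2 ^ (1 / α)) (q.2 ^ (1 / p)) (q.2 ^ (1 / p - 1) • θ))) :
    (∀ w ∈ Weights (n + 1),
      (∀ z ∈ closure (cyl Ω), BddAbove (envelopeValues Ω α p w u z)) ∧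
      IsViscositySubsolution Ω f (lambdaEnvelope Ω α p w u) ∧
      ∀ z ∈ frontier (cyl Ω), lambdaEnvelope Ω α p w u z = 0) ∧
    (WCP Ω f →
      (∀ z ∈ closure (cyl Ω),
        BddAbove ((fun w => lambdaEnvelope Ω α p w u z) '' Weights (n + 1)) ∧
        u z = envelope Ω α p u z) ∧
      IsParabolicallyConcaveOn α p (closure (cyl Ω)) u) := by
  have hα : 0 < α := by linarith
  have huc := hu.continuousOn_closure
  have hnn : ∀ z ∈ closure (cyl Ω), 0 ≤ u z := fun z hz =>
    nonneg_of_mem_closure_cyl hΩ_open hu hu_bdry h_mono hz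
  have hbdd : ∀ w ∈ Weights (n + 1), ∀ z ∈ closure (cyl Ω),
      BddAbove (envelopeValues Ω α p w u z) := fun w hw z _ =>
    (isCompact_envelopeValues hΩ_bdd hα hp0 hw huc z).bddAbove
  have hzero : ∀ w ∈ Weights (n + 1), ∀ z ∈ frontier (cyl Ω), lambdaEnvelope Ω α p w u z = 0 :=
    fun w hw z hz =>
      lambdaEnvelope_eq_zero hΩ_open hΩ_convex hΩ_bdd hα hp0 hw huc hu_bdry hz
  have hsub : ∀ w ∈ Weights (n + 1), IsViscositySubsolution Ω f (lambdaEnvelope Ω α p w u) :=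
    fun w hw => isViscositySubsolution_lambdaEnvelope hΩ_open hΩ_convex hΩ_bdd hp0 hα0 hα1 hu
      hu_bdry h_mono h_growth h_conc hw
  refine ⟨fun w hw => ⟨hbdd w hw, hsub w hw, hzero w hw⟩, fun hWCP => ?_⟩
  have hge : ∀ w ∈ Weights (n + 1), ∀ z ∈ closure (cyl Ω), u z ≤ lambdaEnvelope Ω α p w u z :=
    fun w hw z hz => le_lambdaEnvelope hΩ_bdd hα hp0 hw huc hz (hnn z hz)
  have hle : ∀ w ∈ Weights (n + 1), ∀ z ∈ closure (cyl Ω), lambdaEnvelope Ω α p w u z ≤ u z :=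
    fun w hw => hWCP u (lambdaEnvelope Ω α p w u) hu hnn
      (continuousOn_lambdaEnvelope hΩ_open hΩ_convex hΩ_bdd hp0 hα hu hu_bdry h_mono h_growth hw)
      (hsub w hw) (fun z hz => (hnn z hz).trans (hge w hw z hz))
      fun z hz => by rw [hzero w hw z hz, hu_bdry z hz]
  refine ⟨fun z hz => ?_, isParabolicallyConcaveOn_of_forall_le hn hΩ_convex hnn hbdd hle⟩
  have himage : (fun w => lambdaEnvelope Ω α p w u z) '' Weights (n + 1) = {u z} := by
    refine (Nonempty.image _ ⟨_, cons_mem_weights hn (l := 1 / 2) (by norm_num)⟩)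
      |>.subset_singleton_iff.1 ?_
    rintro _ ⟨w, hw, rfl⟩
    exact le_antisymm (hle w hw z hz) (hge w hw z hz)
  rw [envelope, himage]
  exact ⟨bddAbove_singleton, csSup_singleton _ |>.symm⟩
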